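/- Let $q$ be an indeterminate and work with coefficients in $\mathbb{C}((q^{1/2}))$, with formal ($q$-adic) convergence. Let $\psi_m,\psi^*_m$ ($m\in\mathbb{Z}$) be charged free fermions, $[\psi_m,\psi_n]_+=[\psi^*_m,\psi^*_n]_+=0$, $[\psi_m,\psi^*_n]_+=\delta_{m,n}$, acting from the left on the initial Fock space and from the right on the final Fock space. The basis of the initial space consists of the states $|s\rangle=|j_1,j_2,\dots\rangle$, one for each Maya diagram $s$ with black sites $j_1<j_2<\cdots$ (all sites far to the right black, all sites far to the left white). The basis of the final space consists of the states $\langle\dots,i_2,i_1|$, labelled by the white sites $\cdots<i_2<i_1$ of such a diagram. On initial states, $\psi_m$ removes the black stone at $m=j_k$ with sign $(-1)^{k-1}$, and $\psi^*_m$ inserts a black stone at $m$, $j_k<m<j_{k+1}$, with sign $(-1)^k$ (the result being $0$ when this is impossible). On final states, acting from the right, $\psi_m$ inserts a white stone at $-m$, $i_{k+1}<-m<i_k$, with sign $(-1)^k$, and $\psi^*_m$ removes the white stone at $-m=i_k$ with sign $(-1)^{k-1}$ (again $0$ when impossible). The pairing is $\langle \dots,i_2,i_1|j_1,j_2,\dots\rangle=\prod_k\delta_{i_k+j_k,0}$,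 and $\langle s|$ denotes the final state dual to $|s\rangle$. The vacuum $|0\rangle$ has black sites $\{0,1,2,\dots\}$, and $\langle 0|$ is its dual. Put $$H_m=\sum_{j\in\mathbb{Z}}:\!\psi_j\psi^*_{j+m}\!:\,,\qquad :\!\psi_i\psi_j^*\!:\;=\psi_i\psi_j^*-\langle 0|\psi_i\psi_j^*|0\rangle,$$ $$\Gamma_+(z)=\exp\Big(-\sum_{m\ge1}\frac{z^{-m}}{m}H_m\Big),\qquad \Gamma_-(z)=\exp\Big(-\sum_{m\ge1}\frac{z^{m}}{m}H_{-m}\Big).$$ Then for every Maya diagram $s$ the limits $$L_s=\lim_{M\to\infty}\langle 0|\,\Gamma_+(q^{\frac{-2M+1}{2}})\cdots\Gamma_+(q^{-\frac32})\Gamma_+(q^{-\frac12})\,|s\rangle,\qquad R_s=\lim_{N\to\infty}\langle s|\,\Gamma_-(q^{\frac12})\Gamma_-(q^{\frac32})\cdots\Gamma_-(q^{\frac{2N-1}{2}})\,|0\rangle$$ exist, the family $(L_sR_s)_s$ is summable, and the vacuum expectation value $$S_A(q):=\langle 0|\Big(\cdots\Gamma_+(q^{-\frac32})\Gamma_+(q^{-\frac12})\Big)\Big(\Gamma_-(q^{\frac12})\Gamma_-(q^{\frac32})\cdots\Big)|0\rangle=\sum_s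 L_sR_s$$ satisfies $$S_A(q)=\sum_{\pi}q^{|\pi|}=\prod_{n=1}^{\infty}\left(\frac{1}{1-q^n}\right)^{n},$$ where $\pi$ runs over all plane partitions, i.e. arrays $\pi(i,j)\ge0$ of integers ($i,j\ge1$), weakly decreasing in $i$ and in $j$ and tending to $0$ as $i\to\infty$ for each $j$ and as $j\to\infty$ for each $i$, and $|\pi|=\sum_{i,j}\pi(i,j)$; the sum and the product converge formally. -/

import Mathlib

open Filter Topology

/-! ### Maya diagrams -/

/-- A finite energy Maya diagram: a colouring of `ℤ` by black and white stones such that all sites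
far to the right are black and all sites far to the left are white. It is recorded by its set of
black sites. -/
structure Maya where
  black : Set ℤ
  finite_energy : ∃ N : ℤ, (∀ i, N ≤ i → i ∈ black) ∧ (∀ i, i ≤ -N → i ∉ black)

namespace Maya

/-- Make the stone at site `m` white. -/
def putWhite (m : ℤ) (s : Maya) : Maya where
  black := s.black \ {m}
  finite_energy := by
    obtain ⟨N, h1, h2⟩ := s.finite_energy
    refine ⟨max N (m + 1), fun i hi => ⟨h1 i (by omega), ?_⟩, fun i hi h => h2 i (by omega) h.1⟩
    simp only [Set.mem_singleton_iff]
    omega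

/-- Make the stone at site `m` black. -/
def putBlack (m : ℤ) (s : Maya) : Maya where
  black := insert m s.black
  finite_energy := by
    obtain ⟨N, h1, h2⟩ := s.finite_energy
    refine ⟨max N (-m + 1), fun i hi => Or.inr (h1 i (by omega)), fun i hi h => ?_⟩
    rcases h with h | h
    · omega
    · exact h2 i (by omega) h

/-- The initial vacuum: black stones exactly at the sites `i ≥ 0`. -/
def initialVacuum : Maya where
  black := {i | 0 ≤ i}
  finite_energy := ⟨1, fun i hi => by simp only [Set.mem_ofPred_eq]; omega,
    fun i hi => by simp only [Set.mem_ofPred_eq]; omega⟩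

/-- The final vacuum: black stones exactly at the sites `i > 0`. -/
def finalVacuum : Maya where
  black := {i | 0 < i}
  finite_energy := ⟨1, fun i hi => by simp only [Set.mem_ofPred_eq]; omega,
    fun i hi => by simp only [Set.mem_ofPred_eq]; omega⟩

/-- The final Maya diagram that pairs to `1` with the initial Maya diagram `s`: its white sites
are the negatives of the black sites of `s`. -/
def dual (s : Maya) : Maya where
  black := {i | -i ∉ s.black}
  finite_energy := by
    obtain ⟨N, h1, h2⟩ := s.finite_energy
    exact ⟨N, fun i hi => h2 (-i) (by omega), fun i hi h => h (h1 (-i) (by omega))⟩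

end Maya

noncomputable section

section Fermions

open scoped Classical

variable (K : Type) [Field K]

/-- The initial Fock space (over the field `K`), with basis the initial state vectors
`|j₁, j₂, …⟩`, where `j₁ < j₂ < …` are the black sites of a Maya diagram. -/
abbrev InitialFock : Type := Maya →₀ K

/-- The final Fock space (over the field `K`), with basis the final state vectors
`⟨…, i₂, i₁|`, where `… < i₂ < i₁` are the white sites of a Maya diagram.
Operators act on it from the right: for a right operator `A`, the term `A v` below means `v A`. -/
abbrev FinalFock : Type := Maya →₀ K

/-- The state vector `|s⟩`. -/
def ket (s : Maya) : InitialFock K := Finsupp.single s 1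

/-- The state vector `⟨f|`. -/
def bra (f : Maya) : FinalFock K := Finsupp.single f 1

/-- The inner product `⟨…, i₂, i₁ | j₁, j₂, …⟩ = ∏ δ_{i_k + j_k, 0}`, extended bilinearly. -/
def fockPairing (v : FinalFock K) (w : InitialFock K) : K :=
  v.sum fun f x => w.sum fun s y => if (∀ i : ℤ, i ∉ f.black ↔ -i ∈ s.black) then x * y else 0

/-- Left action of `ψ_m`: it removes the black stone at `m = j_k`, with sign `(-1)^(k-1)`. -/
def psi (m : ℤ) : InitialFock K →ₗ[K] InitialFock K :=
  Finsupp.linearCombination K fun s : Maya =>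
    if m ∈ s.black then
      (-1 : K) ^ Set.ncard {j | j ∈ s.black ∧ j < m} • ket K (s.putWhite m)
    else 0

/-- Left action of `ψ*_m`: it puts a black stone at `m`, where `j_k < m < j_{k+1}`,
with sign `(-1)^k`. -/
def psiStar (m : ℤ) : InitialFock K →ₗ[K] InitialFock K :=
  Finsupp.linearCombination K fun s : Maya =>
    if m ∉ s.black then
      (-1 : K) ^ Set.ncard {j | j ∈ s.black ∧ j < m} • ket K (s.putBlack m)
    else 0

/-- Right action of `ψ_m` on final states: it puts a white stone at `-m`, where
`i_{k+1} < -m < i_k`, with sign `(-1)^k`. -/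
def psiRight (m : ℤ) : FinalFock K →ₗ[K] FinalFock K :=
  Finsupp.linearCombination K fun f : Maya =>
    if -m ∈ f.black then
      (-1 : K) ^ Set.ncard {i | i ∉ f.black ∧ -m < i} • bra K (f.putWhite (-m))
    else 0

/-- Right action of `ψ*_m` on final states: it removes the white stone at `-m = i_k`,
with sign `(-1)^(k-1)`. -/
def psiStarRight (m : ℤ) : FinalFock K →ₗ[K] FinalFock K :=
  Finsupp.linearCombination K fun f : Maya =>
    if -m ∉ f.black then
      (-1 : K) ^ Set.ncard {i | i ∉ f.black ∧ -m < i} • bra K (f.putBlack (-m))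
    else 0

/-- The vacuum expectation value `⟨0| ψ_i ψ*_j |0⟩`. -/
def vacuumExpectation (i j : ℤ) : K :=
  fockPairing K (bra K Maya.finalVacuum) (psi K i (psiStar K j (ket K Maya.initialVacuum)))

/-- `H_m = ∑_j :ψ_j ψ*_{j+m}:` acting on initial states. On each state vector only finitely many
terms of the sum are nonzero. -/
def heisenberg (m : ℤ) : InitialFock K →ₗ[K] InitialFock K :=
  Finsupp.linearCombination K fun s : Maya =>
    ∑ᶠ j : ℤ, (psi K j (psiStar K (j + m) (ket K s)) - vacuumExpectation K j (j + m) • ket K s)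

/-- `H_m = ∑_j :ψ_j ψ*_{j+m}:` acting on final states, from the right. On each state vector only
finitely many terms of the sum are nonzero. -/
def heisenbergRight (m : ℤ) : FinalFock K →ₗ[K] FinalFock K :=
  Finsupp.linearCombination K fun f : Maya =>
    ∑ᶠ j : ℤ,
      (psiStarRight K (j + m) (psiRight K j (bra K f)) - vacuumExpectation K j (j + m) • bra K f)

variable {K}

/-- The specialized time variables `x_m = -z^{-m} / m`. -/
def timeVar (z : K) (m : ℤ) : K := -(z ^ (-m)) / (m : K)

/-- `H_+(z) = ∑_{m ≥ 1} x_m H_m`, acting on initial states. For `m ≥ 1` the operator `H_m` lowers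
the energy by `m`, so only finitely many terms act nontrivially on each state vector. -/
def heisenbergPlus (z : K) : InitialFock K →ₗ[K] InitialFock K :=
  Finsupp.linearCombination K fun s : Maya =>
    ∑ᶠ m : ℕ+, timeVar z ((m : ℕ) : ℤ) • heisenberg K ((m : ℕ) : ℤ) (ket K s)

/-- `H_-(z) = ∑_{m ≤ -1} x_m H_m`, acting on final states from the right. For `m ≤ -1` the right
action of `H_m` lowers the energy by `|m|`, so only finitely many terms act nontrivially on each
state vector. -/
def heisenbergMinus (z : K) : FinalFock K →ₗ[K] FinalFock K :=
  Finsupp.linearCombination K fun f : Maya =>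
    ∑ᶠ m : ℕ+, timeVar z (-((m : ℕ) : ℤ)) • heisenbergRight K (-((m : ℕ) : ℤ)) (bra K f)

/-- The vertex operator `Γ_+(z) = exp (H_+(z))`, acting on initial states. The exponent is locally
nilpotent, so the exponential series is a finite sum on each state vector. -/
def gammaPlus (z : K) : InitialFock K →ₗ[K] InitialFock K :=
  Finsupp.linearCombination K fun s : Maya =>
    ∑ᶠ n : ℕ, ((n.factorial : K)⁻¹) • ((heisenbergPlus z) ^ n) (ket K s)

/-- The vertex operator `Γ_-(z) = exp (-H_-(z))`, acting on final states from the right. The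
exponent is locally nilpotent, so the exponential series is a finite sum on each state vector. -/
def gammaMinus (z : K) : FinalFock K →ₗ[K] FinalFock K :=
  Finsupp.linearCombination K fun f : Maya =>
    ∑ᶠ n : ℕ, ((n.factorial : K)⁻¹) • ((-(heisenbergMinus z)) ^ n) (bra K f)

end Fermions

/-! ### The vacuum expectation value `S_A(q)`

The coefficients are the formal Laurent series over `ℂ` in `q^{1/2}`, with the topology of
formal (`X`-adic) convergence. -/

/-- The field `ℂ((q^{1/2}))`. -/
abbrev QField : Type := LaurentSeries ℂ

/-- The indeterminate `q^{1/2}`. -/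
def sqrtQ : QField := HahnSeries.single 1 1

/-- The indeterminate `q`. -/
def qVar : QField := sqrtQ ^ 2

/-- `Γ_+(q^{(-2M+1)/2}) ⋯ Γ_+(q^{-3/2}) Γ_+(q^{-1/2})`, acting on initial states. -/
def gammaPlusProd : ℕ → InitialFock QField →ₗ[QField] InitialFock QField
  | 0 => LinearMap.id
  | M + 1 => gammaPlus (sqrtQ ^ (-2 * ((M : ℤ) + 1) + 1)) ∘ₗ gammaPlusProd M

/-- `Γ_-(q^{1/2}) Γ_-(q^{3/2}) ⋯ Γ_-(q^{(2N-1)/2})`, acting on final states from the right. -/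
def gammaMinusProd : ℕ → FinalFock QField →ₗ[QField] FinalFock QField
  | 0 => LinearMap.id
  | N + 1 => gammaMinus (sqrtQ ^ (2 * ((N : ℤ) + 1) - 1)) ∘ₗ gammaMinusProd N

/-- `⟨0| Γ_+(q^{(-2M+1)/2}) ⋯ Γ_+(q^{-1/2}) |s⟩`. -/
def plusElement (M : ℕ) (s : Maya) : QField :=
  fockPairing QField (bra QField Maya.finalVacuum) (gammaPlusProd M (ket QField s))

/-- `⟨s| Γ_-(q^{1/2}) ⋯ Γ_-(q^{(2N-1)/2}) |0⟩`, where `⟨s|` is the final state dual to `|s⟩`. -/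
def minusElement (N : ℕ) (s : Maya) : QField :=
  fockPairing QField (gammaMinusProd N (bra QField s.dual)) (ket QField Maya.initialVacuum)

/-- The component along `|s⟩` of the infinite product `⟨0| ⋯ Γ_+(q^{-3/2}) Γ_+(q^{-1/2})`. -/
def plusElementInf (s : Maya) : QField := limUnder atTop fun M => plusElement M s

/-- The component along `⟨s|` of the infinite product `Γ_-(q^{1/2}) Γ_-(q^{3/2}) ⋯ |0⟩`. -/
def minusElementInf (s : Maya) : QField := limUnder atTop fun N => minusElement N s

/-- `S_A(q) = ⟨0| (⋯ Γ_+(q^{-3/2}) Γ_+(q^{-1/2})) (Γ_-(q^{1/2}) Γ_-(q^{3/2}) ⋯) |0⟩`, the scalar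
product of the two infinite products, expanded over the orthonormal basis of state vectors. -/
def vertexExpectation : QField := ∑' s : Maya, plusElementInf s * minusElementInf s

/-! ### Plane partitions -/

/-- A plane partition: non-negative integers `π(i, j)` (with `i, j` counted from `0`), weakly
decreasing in each of the two directions and tending to `0` along each of them. -/
structure PlanePartition where
  height : ℕ → ℕ → ℕ
  antitone_fst : ∀ i j, height (i + 1) j ≤ height i j
  antitone_snd : ∀ i j, height i (j + 1) ≤ height i j
  tendsto_fst : ∀ j, Tendsto (fun i => height i j) atTop (𝓝 0)
  tendsto_snd : ∀ i, Tendsto (fun j => height i j) atTop (𝓝 0)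

namespace PlanePartition

theorem finite_support (π : PlanePartition) :
    (Function.support fun p : ℕ × ℕ => π.height p.1 p.2).Finite := by
  have hi : ∀ i j, π.height i j ≤ π.height i 0 := fun i j =>
    antitone_nat_of_succ_le (f := fun j => π.height i j) (π.antitone_snd i) (Nat.zero_le j)
  have hj : ∀ i j, π.height i j ≤ π.height 0 j := fun i j =>
    antitone_nat_of_succ_le (f := fun i => π.height i j) (fun i => π.antitone_fst i j)
      (Nat.zero_le i)
  have h1 := π.tendsto_fst 0
  have h2 := π.tendsto_snd 0
  rw [nhds_discrete, tendsto_pure, eventually_atTop] at h1 h2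
  obtain ⟨a, ha⟩ := h1
  obtain ⟨b, hb⟩ := h2
  refine ((Set.finite_Iio a).prod (Set.finite_Iio b)).subset fun p hp => ?_
  simp only [Function.mem_support] at hp
  refine ⟨?_, ?_⟩
  · by_contra h
    have := ha p.1 (not_lt.mp h)
    have := hi p.1 p.2
    omega
  · by_contra h
    have := hb p.2 (not_lt.mp h)
    have := hj p.1 p.2
    omega

/-- The number of boxes `|π|`: the sum of all entries, of which finitely many are nonzero. -/
def size (π : PlanePartition) : ℕ := ∑ᶠ p : ℕ × ℕ, π.height p.1 p.2

end PlanePartition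

end

/-! The proof computes both half-infinite products in the basis of Maya diagrams and recognises the
two ends of the identity as two evaluations of one sum over partitions.

A Maya diagram is the same as a charge `c` and a partition `p`, with black sites `k + c - p_k`. The
relation `[H_m, ψ*_k] = -ψ*_{k+m}` for `m > 0` says that commutation with the exponent of `Γ_+(z)`
acts on the generating series of the `ψ*_k` as multiplication by `-log (1 - X/z)`. Exponentiating,
`Γ_+(z) ψ*_j = (∑ z^{-i} ψ*_{j+i}) Γ_+(z)`. Building a state by inserting its black stones from the
right, one obtains `gammaPlus_ket_ofPart`: `Γ_+(z)` sends `|c, p⟩` to the sum of `z^{-(|p| - |r|)}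
|c, r⟩` over the `r` that interlace with `p`. The pairing exchanges the right action of `Γ_-(z)`
with the left action of `Γ_+(z⁻¹)` (`dualFock_gammaMinus`), so `L_s = R_s`. Both vanish for nonzero
charge, and for charge `0` both are limits of `chainSum`, the Schur polynomial of `p` at `q^{1/2},
q^{3/2}, …` written as a sum over interlacing chains.

For the plane partitions, slice `π` along its diagonals: it becomes a pair of interlacing chains
that start at the main diagonal (`diagonalsEquiv`), and Abel summation turns the product of the two
chain weights into `q^{|π|}` (`two_mul_size`). Grouping by the main diagonal gives `∑ L_s R_s = ∑
q^{|π|}`.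

For the product, the Cauchy identity `hasSum_chainSum_mul_chainSum` evaluates the sum for chains of
length at most `N` as the product of the `1 / (1 - q^{i+j+1})` with `i, j < N`. It rests on the
commutation rule `hasSum_strip_mul_strip`, which is proved by the bijection `exchange`. The error of
this truncation has order at least `N` in `q^{1/2}`, and exactly `n` pairs `(i, j)` give the
exponent `n = i + j + 1`. -/

noncomputable section

/-! ### Formal convergence of Laurent series -/

namespace QField

-- Valuation balls form a neighbourhood basis, and lying in such a ball means that all coefficients
-- below some degree vanish.
open WithZero in
theorem tendsto_of_coeff {ι : Type*} {l : Filter ι} {f : ι → QField} {a : QField}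
    (h : ∀ n : ℤ, ∀ᶠ x in l, ∀ d < n, (f x).coeff d = a.coeff d) : Tendsto f l (𝓝 a) := by
  intro U hU
  obtain ⟨γ, hU₁⟩ := Valued.mem_nhds.mp hU
  set γ' := MonoidWithZeroHom.ValueGroup₀.embedding γ.1 with hγ'
  -- The cutoff `n = -(log γ' - 1)` is chosen one step inside the ball, because the ball is given by
  -- a strict inequality.
  have hD : exp (-(-(log γ' - 1))) < γ' := by
    rw [← lt_log_iff_exp_lt (by simp [γ'])]
    simp
  refine (h (-(log γ' - 1))).mono fun x hx => ?_
  apply hU₁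
  simp only [Set.mem_ofPred_eq]
  rw [Valuation.restrict_lt_iff_lt_embedding]
  refine lt_of_le_of_lt ((LaurentSeries.valuation_le_iff_coeff_lt_eq_zero ℂ).mpr fun n hn => ?_) hD
  rw [HahnSeries.coeff_sub, hx n hn, sub_self]

theorem tendsto_coeff {ι : Type*} {l : Filter ι} {f : ι → QField} {a : QField}
    (h : Tendsto f l (𝓝 a)) (d : ℤ) : ∀ᶠ x in l, (f x).coeff d = a.coeff d := by
  -- With the discrete uniformity on `ℂ` the coefficient maps are continuous, and convergence of a
  -- coefficient means that it is eventually constant.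
  let _ : UniformSpace ℂ := ⊥
  have := ((LaurentSeries.uniformContinuous_coeff (K := ℂ) d).continuous.tendsto a).comp h
  rw [nhds_discrete] at this
  exact tendsto_pure.mp this

/-- The Laurent series whose coefficients of degree `< n` vanish. -/
def vanishing (n : ℤ) : AddSubgroup QField where
  carrier := {f | ∀ d < n, f.coeff d = 0}
  add_mem' ha hb d hd := by simp [ha d hd, hb d hd]
  zero_mem' := by simp
  neg_mem' ha d hd := by simp [ha d hd]

theorem mem_vanishing_iff_valued {n : ℤ} {f : QField} :
    f ∈ vanishing n ↔ Valued.v f ≤ WithZero.exp (-n) :=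
  (LaurentSeries.valuation_le_iff_coeff_lt_eq_zero ℂ).symm

theorem vanishing_anti {m n : ℤ} (h : m ≤ n) : vanishing n ≤ vanishing m :=
  fun _ hf d hd => hf d (by omega)

theorem mul_mem_vanishing {m n : ℤ} {f g : QField} (hf : f ∈ vanishing m) (hg : g ∈ vanishing n) :
    f * g ∈ vanishing (m + n) := by
  rw [mem_vanishing_iff_valued] at *
  rw [map_mul, neg_add, WithZero.exp_add]
  exact mul_le_mul' hf hg

theorem mul_mem_vanishing_left {n : ℤ} {f g : QField} (hf : f ∈ vanishing n)
    (hg : g ∈ vanishing 0) : f * g ∈ vanishing n := by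
  simpa using mul_mem_vanishing hf hg

theorem sqrtQ_pow (n : ℕ) : sqrtQ ^ n = HahnSeries.single (n : ℤ) 1 := by
  simp [sqrtQ, HahnSeries.single_pow]

theorem sqrtQ_pow_mem {m : ℤ} {n : ℕ} (h : m ≤ n) : sqrtQ ^ n ∈ vanishing m := by
  intro d hd
  rw [sqrtQ_pow]
  exact HahnSeries.coeff_single_of_ne (by omega)

theorem one_mem_vanishing : (1 : QField) ∈ vanishing 0 := by
  simpa using sqrtQ_pow_mem (m := 0) (n := 0) le_rfl

theorem tendsto_of_sub_mem {ι : Type*} {l : Filter ι} {f : ι → QField} {a : QField}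
    (h : ∀ n : ℕ, ∀ᶠ x in l, f x - a ∈ vanishing n) : Tendsto f l (𝓝 a) := by
  refine tendsto_of_coeff fun n => (h n.toNat).mono fun x hx d hd => ?_
  have := hx d (by omega)
  rwa [HahnSeries.coeff_sub, sub_eq_zero] at this

instance : NonarchimedeanRing QField :=
  ((PowerSeries.idealX ℂ).valuation QField).subgroups_basis.nonarchimedean

theorem summable_of_vanishing {ι : Type*} {f : ι → QField}
    (h : ∀ n : ℕ, {i | f i ∉ vanishing n}.Finite) : Summable f := by
  refine NonarchimedeanAddGroup.summable_of_tendsto_cofinite_zero (tendsto_of_sub_mem fun n => ?_)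
  simp only [sub_zero]
  exact h n

/-- The valuation of `1 - f` is `1`, and `(1 - f)⁻¹ - 1 = f (1 - f)⁻¹`. -/
theorem inv_one_sub_mem {f : QField} {n : ℕ} (hf : f ∈ vanishing (n + 1)) :
    (1 - f)⁻¹ - 1 ∈ vanishing (n + 1) ∧ 1 - f ≠ 0 := by
  have hlt : Valued.v f < 1 := by
    refine lt_of_le_of_lt (mem_vanishing_iff_valued.mp hf) ?_
    rw [← WithZero.exp_zero, WithZero.exp_lt_exp]
    omega
  have hv : Valued.v (1 - f) = 1 := by
    rw [Valuation.map_one_sub_of_lt _ hlt]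
  have h0 : 1 - f ≠ 0 := by
    intro h
    rw [h, map_zero] at hv
    exact zero_ne_one hv
  refine ⟨?_, h0⟩
  have : (1 - f)⁻¹ - 1 = f * (1 - f)⁻¹ := by field_simp; ring
  rw [this, mem_vanishing_iff_valued, map_mul, map_inv₀, hv, inv_one, mul_one]
  exact mem_vanishing_iff_valued.mp hf

theorem summable_sqrtQ_pow {ι : Type*} {w : ι → ℕ} (hw : ∀ n, {i | w i = n}.Finite) :
    Summable fun i => sqrtQ ^ w i := by
  refine summable_of_vanishing fun n => ?_
  refine (((Set.finite_Iio n).biUnion fun m _ => hw m)).subset fun i hi => ?_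
  simp only [Set.mem_iUnion, Set.mem_Iio, Set.mem_ofPred_eq, exists_prop, exists_eq_right']
  by_contra hc
  exact hi (sqrtQ_pow_mem (by exact_mod_cast not_lt.mp hc))

end QField

/-! ### Partitions as weakly decreasing sequences -/

/-- A partition, recorded as a weakly decreasing sequence that is eventually zero. -/
@[ext]
structure PartSeq where
  part : ℕ → ℕ
  anti : Antitone part
  eventually_zero : ∃ n, ∀ k, n ≤ k → part k = 0

namespace PartSeq

instance : Zero PartSeq := ⟨⟨fun _ => 0, fun _ _ _ => le_rfl, 0, fun _ _ => rfl⟩⟩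

@[simp] theorem zero_part (k : ℕ) : (0 : PartSeq).part k = 0 := rfl

/-- The number of boxes of a partition. -/
def size (p : PartSeq) : ℕ := ∑ᶠ k, p.part k

theorem size_eq_sum (p : PartSeq) {n : ℕ} (h : ∀ k, n ≤ k → p.part k = 0) :
    p.size = ∑ k ∈ Finset.range n, p.part k := by
  refine finsum_eq_finsetSum_of_support_subset _ fun k hk => ?_
  simp only [Finset.coe_range, Set.mem_Iio]
  by_contra hc
  exact hk (h k (not_lt.mp hc))

@[simp] theorem size_zero : (0 : PartSeq).size = 0 := by
  rw [size_eq_sum (0 : PartSeq) (n := 0) fun _ _ => rfl, Finset.sum_range_zero]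

theorem zero_of_le {p : PartSeq} {n k : ℕ} (h : p.part n = 0) (hk : n ≤ k) : p.part k = 0 :=
  Nat.le_zero.mp (h ▸ p.anti hk)

theorem eq_zero_of_part_zero {p : PartSeq} (h : p.part 0 = 0) : p = 0 :=
  PartSeq.ext (funext fun k => zero_of_le h (Nat.zero_le k))

theorem size_mono {p r : PartSeq} (h : ∀ k, p.part k ≤ r.part k) : p.size ≤ r.size := by
  obtain ⟨n, hn⟩ := r.eventually_zero
  rw [r.size_eq_sum hn, p.size_eq_sum fun k hk => Nat.le_zero.mp (hn k hk ▸ h k)]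
  exact Finset.sum_le_sum fun k _ => h k

/-- The `k + 1` parts of index `0, …, k` are all at least `1`. -/
theorem le_size_of_part_ne_zero (p : PartSeq) {k : ℕ} (h : p.part k ≠ 0) : k < p.size := by
  obtain ⟨n, hn⟩ := p.eventually_zero
  have hk : k < n := by
    by_contra hc
    exact h (hn k (not_lt.mp hc))
  rw [p.size_eq_sum hn]
  calc k < ∑ i ∈ Finset.range (k + 1), 1 := by simp
    _ ≤ ∑ i ∈ Finset.range (k + 1), p.part i := Finset.sum_le_sum fun i hi => by
        have := p.anti (Nat.lt_succ_iff.mp (Finset.mem_range.mp hi))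
        omega
    _ ≤ _ := Finset.sum_le_sum_of_subset (Finset.range_mono hk)

theorem part_le_size (p : PartSeq) (k : ℕ) : p.part k ≤ p.size := by
  by_cases h : p.part k = 0
  · omega
  obtain ⟨n, hn⟩ := p.eventually_zero
  rw [p.size_eq_sum hn]
  refine Finset.single_le_sum (f := p.part) (fun _ _ => Nat.zero_le _) (Finset.mem_range.mpr ?_)
  by_contra hc
  exact h (hn k (not_lt.mp hc))

theorem size_eq_zero_iff {p : PartSeq} : p.size = 0 ↔ p = 0 :=
  ⟨fun h => eq_zero_of_part_zero (Nat.le_zero.mp (h ▸ p.part_le_size 0)), fun h => h ▸ size_zero⟩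

theorem finite_size_le (n : ℕ) : {p : PartSeq | p.size ≤ n}.Finite := by
  -- A partition of size at most `n` has at most `n` nonzero parts, each at most `n`, so its first
  -- `n` parts determine it.
  let f : {p : PartSeq | p.size ≤ n} → (Fin n → Fin (n + 1)) := fun p k =>
    ⟨p.1.part k, Nat.lt_succ_iff.mpr ((p.1.part_le_size k).trans p.2)⟩
  have hf : Function.Injective f := by
    rintro ⟨p, hp⟩ ⟨r, hr⟩ h
    refine Subtype.ext (PartSeq.ext (funext fun k => ?_))
    by_cases hk : k < n
    · simpa [f] using congrFun h ⟨k, hk⟩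
    · have h0 : ∀ s : PartSeq, s.size ≤ n → s.part k = 0 := fun s hs => by
        by_contra hc
        have := s.le_size_of_part_ne_zero hc
        omega
      rw [h0 p hp, h0 r hr]
  have := Finite.of_injective f hf
  exact Set.toFinite _

/-- `Interlace p r` says that `r₀ ≥ p₀ ≥ r₁ ≥ p₁ ≥ ⋯`, i.e. that `r / p` is a horizontal strip. -/
def Interlace (p r : PartSeq) : Prop := ∀ k, p.part k ≤ r.part k ∧ r.part (k + 1) ≤ p.part k

theorem Interlace.size_le {p r : PartSeq} (h : Interlace p r) : p.size ≤ r.size :=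
  size_mono fun k => (h k).1

theorem interlace_zero_iff {p : PartSeq} : Interlace p 0 ↔ p = 0 := by
  refine ⟨fun h => eq_zero_of_part_zero (Nat.le_zero.mp (h 0).1), ?_⟩
  rintro rfl k
  simp

theorem zero_interlace_zero : Interlace 0 0 := interlace_zero_iff.mpr rfl

theorem finite_interlace (r : PartSeq) : {p | Interlace p r}.Finite :=
  (finite_size_le r.size).subset fun _ h => Interlace.size_le h

/-- The finite set of the partitions `p` for which `r / p` is a horizontal strip. -/
def below (r : PartSeq) : Finset PartSeq := (finite_interlace r).toFinset

@[simp] theorem mem_below {p r : PartSeq} : p ∈ below r ↔ Interlace p r := by simp [below]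

theorem below_zero : below 0 = {0} := by
  ext p
  simp [interlace_zero_iff]

/-- Add a largest part `a` in front of `p` (or `p₀`, if `a < p₀`). -/
def cons (a : ℕ) (p : PartSeq) : PartSeq where
  part k := Nat.casesOn k (max a (p.part 0)) p.part
  anti := antitone_nat_of_succ_le fun k => by
    cases k with
    | zero => exact le_max_right _ _
    | succ k => exact p.anti (Nat.le_succ k)
  eventually_zero := by
    obtain ⟨n, hn⟩ := p.eventually_zero
    refine ⟨n + 1, fun k hk => ?_⟩
    cases k with
    | zero => omega
    | succ k => exact hn k (by omega)

theorem cons_part_zero {a : ℕ} {p : PartSeq} (h : p.part 0 ≤ a) : (cons a p).part 0 = a :=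
  max_eq_left h

@[simp] theorem cons_part_succ (a : ℕ) (p : PartSeq) (k : ℕ) :
    (cons a p).part (k + 1) = p.part k := rfl

/-- Remove the largest part. -/
def tail (p : PartSeq) : PartSeq where
  part k := p.part (k + 1)
  anti _ _ h := p.anti (by omega)
  eventually_zero := by
    obtain ⟨n, hn⟩ := p.eventually_zero
    exact ⟨n, fun k hk => hn _ (by omega)⟩

@[simp] theorem tail_part (p : PartSeq) (k : ℕ) : p.tail.part k = p.part (k + 1) := rfl

@[simp] theorem tail_cons (a : ℕ) (p : PartSeq) : (cons a p).tail = p := rfl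

theorem cons_tail (p : PartSeq) : cons (p.part 0) p.tail = p := by
  ext k
  cases k with
  | zero => exact cons_part_zero (p.anti (Nat.zero_le 1))
  | succ k => rfl

theorem size_cons {a : ℕ} {p : PartSeq} (h : p.part 0 ≤ a) : (cons a p).size = a + p.size := by
  obtain ⟨n, hn⟩ := p.eventually_zero
  rw [p.size_eq_sum hn, size_eq_sum (n := n + 1), Finset.sum_range_succ', cons_part_zero h, add_comm]
  · rfl
  · intro k hk
    cases k with
    | zero => omega
    | succ k => exact hn k (by omega)

/-- The interlacing conditions decouple: the largest part ranges over `[r₀, a]` independently of the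
remaining parts. This is the combinatorial shadow of inserting one more black stone. -/
theorem sum_below_cons {M : Type*} [AddCommMonoid M] {a : ℕ} {r : PartSeq} (h : r.part 0 ≤ a)
    (f : PartSeq → M) : ∑ p ∈ below (cons a r), f p =
      ∑ b ∈ Finset.Icc (r.part 0) a, ∑ p ∈ below r, f (cons b p) := by
  rw [← Finset.sum_product']
  symm
  refine Finset.sum_bij' (fun x _ => cons x.1 x.2) (fun p _ => (p.part 0, p.tail)) ?_ ?_ ?_ ?_ ?_
  · rintro ⟨b, p⟩ hx
    simp only [Finset.mem_product, Finset.mem_Icc, mem_below] at hx ⊢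
    intro k
    cases k with
    | zero =>
      rw [cons_part_zero h, cons_part_zero ((hx.2 0).1.trans hx.1.1)]
      exact ⟨hx.1.2, hx.1.1⟩
    | succ k => exact hx.2 k
  · intro p hp
    simp only [Finset.mem_product, Finset.mem_Icc, mem_below] at hp ⊢
    have h0 := hp 0
    rw [cons_part_zero h] at h0
    exact ⟨⟨h0.2, h0.1⟩, fun k => hp (k + 1)⟩
  · rintro ⟨b, p⟩ hx
    simp only [Finset.mem_product, Finset.mem_Icc, mem_below] at hx
    simp [cons_part_zero ((hx.2 0).1.trans hx.1.1)]
  · intro p _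
    exact cons_tail p
  · intros
    rfl

/-- The parts of the partition that corresponds to `k` and `r` under `PartSeq.exchange`. -/
def exchangeInv (t u : PartSeq) (k : ℕ) (r : PartSeq) : ℕ → ℕ
  | 0 => max (t.part 0) (u.part 0) + k
  | i + 1 => min (t.part i) (u.part i) + max (t.part (i + 1)) (u.part (i + 1)) - r.part i

/-- The local exchange rule of horizontal strips: reflecting the parts of `s` in the intervals
prescribed by `t` and `u`. -/
def exchange (t u : PartSeq) : {s // Interlace t s ∧ Interlace u s} ≃
    ℕ × {r // Interlace r t ∧ Interlace r u} where
  -- For `i ≥ 0` both `s_{i+1}` and the new part `r_i` are confined to the interval from `max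
  -- (t_{i+1}, u_{i+1})` to `min (t_i, u_i)`, so reflecting in it is an involution. The part `s_0`
  -- is bounded only from below; its excess is the free natural number.
  toFun s := (s.1.part 0 - max (t.part 0) (u.part 0),
    ⟨{
      part := fun i => min (t.part i) (u.part i) + max (t.part (i + 1)) (u.part (i + 1))
        - s.1.part (i + 1)
      anti := antitone_nat_of_succ_le fun i => by
        have h1 := s.2.1 i
        have h2 := s.2.2 i
        have h3 := s.2.1 (i + 1)
        have h4 := s.2.2 (i + 1)
        have h5 := s.2.1 (i + 1 + 1)
        have h6 := s.2.2 (i + 1 + 1)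
        omega
      eventually_zero := by
        obtain ⟨n, hn⟩ := t.eventually_zero
        refine ⟨n, fun k hk => ?_⟩
        have h1 := hn k hk
        have h2 := hn (k + 1) (by omega)
        have h3 := s.2.2 (k + 1)
        omega}, by
      constructor
      all_goals
        intro k
        have h1 := s.2.1 k
        have h2 := s.2.2 k
        have h3 := s.2.1 (k + 1)
        have h4 := s.2.2 (k + 1)
        dsimp only
        omega⟩)
  invFun x := ⟨{
      part := exchangeInv t u x.1 x.2.1
      anti := antitone_nat_of_succ_le fun i => by
        cases i with
        | zero =>
          have h1 := x.2.2.1 0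
          have h2 := x.2.2.2 0
          simp only [exchangeInv]
          omega
        | succ i =>
          have h1 := x.2.2.1 i
          have h2 := x.2.2.2 i
          have h3 := x.2.2.1 (i + 1)
          have h4 := x.2.2.2 (i + 1)
          simp only [exchangeInv]
          omega
      eventually_zero := by
        obtain ⟨n, hn⟩ := t.eventually_zero
        refine ⟨n + 1, fun k hk => ?_⟩
        cases k with
        | zero => omega
        | succ k =>
          have h1 := hn k (by omega)
          have h2 := hn (k + 1) (by omega)
          have h3 := x.2.2.2 k
          simp only [exchangeInv]
          omega}, by
      constructor
      all_goals
        intro k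
        have h1 := x.2.2.1 k
        have h2 := x.2.2.2 k
        cases k with
        | zero => simp only [exchangeInv]; omega
        | succ k =>
          have h3 := x.2.2.1 k
          have h4 := x.2.2.2 k
          simp only [exchangeInv]
          omega⟩
  left_inv s := by
    refine Subtype.ext (PartSeq.ext (funext fun k => ?_))
    cases k with
    | zero =>
      have h1 := s.2.1 0
      have h2 := s.2.2 0
      simp only [exchangeInv]
      omega
    | succ k =>
      have h1 := s.2.1 k
      have h2 := s.2.2 k
      have h3 := s.2.1 (k + 1)
      have h4 := s.2.2 (k + 1)
      simp only [exchangeInv]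
      omega
  right_inv x := by
    refine Prod.ext ?_ (Subtype.ext (PartSeq.ext (funext fun k => ?_)))
    · simp only [exchangeInv]
      omega
    · have h1 := x.2.2.1 k
      have h2 := x.2.2.2 k
      simp only [exchangeInv]
      omega

theorem exchange_fst {t u : PartSeq} (s : {s // Interlace t s ∧ Interlace u s}) :
    (exchange t u s).1 = s.1.part 0 - max (t.part 0) (u.part 0) := rfl

theorem exchange_snd_part {t u : PartSeq} (s : {s // Interlace t s ∧ Interlace u s}) (i : ℕ) :
    (exchange t u s).2.1.part i =
      min (t.part i) (u.part i) + max (t.part (i + 1)) (u.part (i + 1)) - s.1.part (i + 1) := rfl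

/-- Reflection gives `s_{i+1} + r_i = min + max`, and summing `min (t_i, u_i) + max (t_i, u_i) = t_i
+ u_i` yields `|t| + |u|`; the excess of `s_0` is what remains. -/
theorem size_exchange {t u : PartSeq} (s : {s // Interlace t s ∧ Interlace u s}) :
    s.1.size + (exchange t u s).2.1.size = (exchange t u s).1 + t.size + u.size := by
  obtain ⟨n, hn⟩ := t.eventually_zero
  obtain ⟨m, hm⟩ := u.eventually_zero
  set N := max n m
  have ht : ∀ k, N ≤ k → t.part k = 0 := fun k hk => hn k (by omega)
  have hu : ∀ k, N ≤ k → u.part k = 0 := fun k hk => hm k (by omega)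
  have hs : ∀ k, N + 1 ≤ k → s.1.part k = 0 := fun k hk => by
    have := s.2.1 (k - 1)
    rw [show k - 1 + 1 = k by omega, ht (k - 1) (by omega)] at this
    omega
  have hr : ∀ k, N ≤ k → (exchange t u s).2.1.part k = 0 := fun k hk =>
    Nat.le_zero.mp (ht k hk ▸ ((exchange t u s).2.2.1 k).1)
  rw [s.1.size_eq_sum hs, size_eq_sum _ hr, t.size_eq_sum (n := N + 1) fun k hk => ht k (by omega),
    u.size_eq_sum (n := N + 1) fun k hk => hu k (by omega), Finset.sum_range_succ',
    add_right_comm, ← Finset.sum_add_distrib]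
  have h1 : ∀ k, s.1.part (k + 1) + (exchange t u s).2.1.part k =
      min (t.part k) (u.part k) + max (t.part (k + 1)) (u.part (k + 1)) := fun k => by
    have h1 := s.2.1 k
    have h2 := s.2.2 k
    have h3 := s.2.1 (k + 1)
    have h4 := s.2.2 (k + 1)
    rw [exchange_snd_part]
    omega
  have h0 : s.1.part 0 = max (t.part 0) (u.part 0) + (exchange t u s).1 := by
    have h1 := s.2.1 0
    have h2 := s.2.2 0
    rw [exchange_fst]
    omega
  rw [Finset.sum_congr rfl fun k _ => h1 k, Finset.sum_add_distrib, h0]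
  have h2 : ∑ k ∈ Finset.range (N + 1), t.part k + ∑ k ∈ Finset.range (N + 1), u.part k =
      ∑ k ∈ Finset.range N, min (t.part k) (u.part k) +
      (∑ k ∈ Finset.range N, max (t.part (k + 1)) (u.part (k + 1)) + max (t.part 0) (u.part 0)) := by
    rw [← Finset.sum_range_succ' fun k => max (t.part k) (u.part k),
      ← Finset.sum_add_distrib, Finset.sum_congr rfl fun k _ => (min_add_max (t.part k) (u.part k)).symm,
      Finset.sum_add_distrib, Finset.sum_range_succ fun k => min (t.part k) (u.part k),
      ht N le_rfl, hu N le_rfl]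
    simp
  omega

end PartSeq

/-! ### The Cauchy identity -/

section ChainSum

open scoped Classical

namespace PartSeq

variable {K : Type*} [Field K]

/-- The matrix element `x ^ (|r| - |p|)` of a horizontal strip `r / p`. -/
def strip (x : K) (p r : PartSeq) : K := if Interlace p r then x ^ (r.size - p.size) else 0

theorem strip_of_mem {x : K} {p r : PartSeq} (h : p ∈ below r) :
    strip x p r = x ^ (r.size - p.size) := if_pos (mem_below.mp h)

theorem strip_of_notMem {x : K} {p r : PartSeq} (h : p ∉ below r) : strip x p r = 0 :=
  if_neg fun hc => h (mem_below.mpr hc)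

/-- The sum of `∏ u_k ^ (|p_k| - |p_{k+1}|)` over the interlacing chains
`p = p_0 ≻ p_1 ≻ ⋯ ≻ p_N = 0`. -/
def chainSum : ℕ → (ℕ → K) → PartSeq → K
  | 0, _, p => if p = 0 then 1 else 0
  | N + 1, u, p => ∑ r ∈ below p, strip (u 0) r p * chainSum N (fun i => u (i + 1)) r

theorem chainSum_zero_partSeq (N : ℕ) (u : ℕ → K) : chainSum N u 0 = 1 := by
  induction N generalizing u with
  | zero => simp [chainSum]
  | succ N ih => simp [chainSum, below_zero, ih, strip, zero_interlace_zero]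

end PartSeq

namespace QField

open PartSeq

theorem pow_mem_vanishing {x : QField} (hx : x ∈ vanishing 1) (n : ℕ) : x ^ n ∈ vanishing n := by
  induction n with
  | zero => simpa using one_mem_vanishing
  | succ n ih => simpa [pow_succ] using mul_mem_vanishing ih hx

theorem strip_mem {x : QField} (hx : x ∈ vanishing 1) (p r : PartSeq) :
    strip x p r ∈ vanishing ((r.size : ℤ) - p.size) := by
  unfold strip
  split_ifs with h
  · have := pow_mem_vanishing hx (r.size - p.size)
    rwa [Nat.cast_sub h.size_le] at this
  · exact AddSubgroup.zero_mem _

theorem chainSum_mem {u : ℕ → QField} (hu : ∀ i, u i ∈ vanishing 1) (N : ℕ) (p : PartSeq) :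
    chainSum N u p ∈ vanishing p.size := by
  induction N generalizing u p with
  | zero =>
    unfold chainSum
    split_ifs with h
    · subst h
      simpa using one_mem_vanishing
    · exact AddSubgroup.zero_mem _
  | succ N ih =>
    refine AddSubgroup.sum_mem _ fun r _ => ?_
    simpa using mul_mem_vanishing (strip_mem (hu 0) r p) (ih (fun i => hu (i + 1)) r)

theorem hasSum_geometric {z : QField} (hz : z ∈ vanishing 1) :
    HasSum (fun k : ℕ => z ^ k) (1 - z)⁻¹ := by
  have hs : Summable fun k : ℕ => z ^ k := summable_of_vanishing fun n => by
    refine (Set.finite_Iio n).subset fun k hk => ?_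
    by_contra hc
    exact hk (vanishing_anti (by simpa using hc) (pow_mem_vanishing hz k))
  have h0 : 1 - z ≠ 0 := (inv_one_sub_mem (n := 0) (by simpa using hz)).2
  have h1 : (1 - z) * ∑' k : ℕ, z ^ k = 1 := by
    have h2 := hs.tsum_eq_zero_add
    simp_rw [pow_succ', tsum_mul_left] at h2
    rw [sub_mul, one_mul, sub_eq_iff_eq_add]
    simpa using h2
  rw [inv_eq_of_mul_eq_one_right h1]
  exact hs.hasSum

/-- The commutation relation of `Γ_+` and `Γ_-` in matrix form. Under `exchange` the summand factors
into a geometric term `(xy)^k` and a summand of the right-hand side. -/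
theorem hasSum_strip_mul_strip {x y : QField} (hx : x ∈ vanishing 1) (hy : y ∈ vanishing 1)
    (t u : PartSeq) : HasSum (fun s => strip x t s * strip y u s)
      ((1 - x * y)⁻¹ * ∑ r ∈ below t, strip y r t * strip x r u) := by
  have hxy : x * y ∈ vanishing 1 := vanishing_anti (by simp) (mul_mem_vanishing hx hy)
  have hr : HasSum (fun r : {r // Interlace r t ∧ Interlace r u} =>
      strip y r.1 t * strip x r.1 u) (∑ r ∈ below t, strip y r t * strip x r u) := by
    refine (hasSum_subtype_iff_of_support_subset (s := {r | Interlace r t ∧ Interlace r u})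
      (f := fun r => strip y r t * strip x r u) fun r h => ?_).mpr
      (hasSum_sum_of_ne_finset_zero fun r h => by rw [strip_of_notMem h, zero_mul])
    by_contra hc
    refine h ?_
    rw [Set.mem_ofPred_eq, not_and_or] at hc
    rcases hc with hc | hc <;> simp [strip, hc]
  have hs : HasSum (fun s : {s // Interlace t s ∧ Interlace u s} => strip x t s.1 * strip y u s.1)
      ((1 - x * y)⁻¹ * ∑ r ∈ below t, strip y r t * strip x r u) := by
    rw [← (exchange t u).symm.hasSum_iff]
    refine ((hasSum_geometric hxy).mul_of_nonarchimedean hr).congr_fun fun a => ?_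
    obtain ⟨s, rfl⟩ := (exchange t u).surjective a
    have h1 := s.2.1.size_le
    have h2 := s.2.2.size_le
    have h3 := (exchange t u s).2.2.1.size_le
    have h4 := (exchange t u s).2.2.2.size_le
    have h5 := size_exchange s
    simp only [Function.comp_apply, Equiv.symm_apply_apply, strip, s.2.1, s.2.2,
      (exchange t u s).2.2.1, (exchange t u s).2.2.2, if_true]
    rw [show s.1.size - t.size = (exchange t u s).1 + (u.size - (exchange t u s).2.1.size) by omega,
      show s.1.size - u.size = (exchange t u s).1 + (t.size - (exchange t u s).2.1.size) by omega]
    ring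
  refine (hasSum_subtype_iff_of_support_subset (s := {s | Interlace t s ∧ Interlace u s})
      (f := fun s => strip x t s * strip y u s) fun s h => ?_).mp hs
  by_contra hc
  refine h ?_
  rw [Set.mem_ofPred_eq, not_and_or] at hc
  rcases hc with hc | hc <;> simp [strip, hc]

theorem hasSum_strip_mul (x : QField) (f : PartSeq → QField) (s : PartSeq) :
    HasSum (fun u => strip x u s * f u) (∑ u ∈ below s, strip x u s * f u) :=
  hasSum_sum_of_ne_finset_zero fun u h => by rw [strip_of_notMem h, zero_mul]

/-- Below a given order only finitely many `s` contribute, and each has only finitely many `u` below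
it; this licenses interchanging the two summations. -/
theorem summable_strip_mul {g : PartSeq → PartSeq → QField} {c : ℕ}
    (hg : ∀ s u, Interlace u s → g s u ∈ vanishing ((s.size : ℤ) - c))
    (hg0 : ∀ s u, ¬ Interlace u s → g s u = 0) : Summable fun x : PartSeq × PartSeq => g x.1 x.2 := by
  refine summable_of_vanishing fun n => ?_
  refine ((finite_size_le (n + c)).prod (finite_size_le (n + c))).subset ?_
  rintro ⟨s, u⟩ h
  have hi : Interlace u s := by
    by_contra hc
    refine h ?_
    rw [hg0 s u hc]
    exact AddSubgroup.zero_mem _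
  have hs : s.size ≤ n + c := by
    by_contra hc
    exact h (vanishing_anti (by omega) (hg s u hi))
  exact ⟨hs, hi.size_le.trans hs⟩

/-- The chain sums are eigenvectors of the transposed strip matrices. -/
theorem hasSum_strip_mul_chainSum {x : QField} (hx : x ∈ vanishing 1) (N : ℕ) {y : ℕ → QField}
    (hy : ∀ i, y i ∈ vanishing 1) (t : PartSeq) :
    HasSum (fun s => strip x t s * chainSum N y s)
      ((∏ j ∈ Finset.range N, (1 - x * y j)⁻¹) * chainSum N y t) := by
  induction N generalizing y t with
  | zero =>
    convert hasSum_single (f := fun s => strip x t s * chainSum 0 y s) 0 ?_ using 1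
    · by_cases h : t = 0 <;> simp [chainSum, strip, h, interlace_zero_iff]
    · intro s hs
      simp [chainSum, hs]
  | succ N ih =>
    set y' := fun i => y (i + 1) with hy'
    have hf : Summable fun a : PartSeq × PartSeq =>
        strip x t a.1 * (strip (y 0) a.2 a.1 * chainSum N y' a.2) := by
      refine summable_strip_mul (g := fun s u => strip x t s * (strip (y 0) u s * chainSum N y' u))
        (c := t.size) (fun s u _ => ?_) fun s u h => ?_
      · have h1 := mul_mem_vanishing (strip_mem (hy 0) u s)
          (chainSum_mem (fun i => hy (i + 1)) N u)
        have h2 := mul_mem_vanishing (strip_mem hx t s) h1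
        exact vanishing_anti (by omega) h2
      · simp [strip, h]
    -- The double sum over `(s, u)` is evaluated twice. Summing over `u` first gives the left-hand
    -- side; summing over `s` first allows the commutation rule and then the induction hypothesis.
    have h1 := hf.hasSum.prod_fiberwise fun s =>
      (hasSum_strip_mul (y 0) (chainSum N y') s).mul_left (strip x t s)
    have h2 := (Equiv.prodComm PartSeq PartSeq).hasSum_iff.mpr hf.hasSum
    have h3 := h2.prod_fiberwise fun u => by
      have := (hasSum_strip_mul_strip hx (hy 0) t u).mul_right (chainSum N y' u)
      refine this.congr_fun fun s => ?_
      simp [mul_assoc]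
    have h4 : HasSum (fun u => (1 - x * y 0)⁻¹ * ∑ r ∈ below t,
        strip (y 0) r t * (strip x r u * chainSum N y' u))
        ((1 - x * y 0)⁻¹ * ∑ r ∈ below t, strip (y 0) r t *
          ((∏ j ∈ Finset.range N, (1 - x * y' j)⁻¹) * chainSum N y' r)) :=
      (hasSum_sum fun r _ => (ih (fun i => hy (i + 1)) r).mul_left _).mul_left _
    have h5 := h3.unique (h4.congr_fun fun u => by
      simp only [Finset.sum_mul, Finset.mul_sum, mul_assoc])
    rw [h5] at h1
    convert h1 using 1
    · rfl
    rw [Finset.prod_range_succ', chainSum, Finset.mul_sum, Finset.mul_sum]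
    refine Finset.sum_congr rfl fun r _ => ?_
    ring

/-- The Cauchy identity for Schur polynomials. Peeling off one variable `x 0` leaves a transposed
strip matrix acting on the `y`-chain sums, which are eigenvectors with eigenvalue `∏ (1 - x₀
y_j)⁻¹`. -/
theorem hasSum_chainSum_mul_chainSum (M N : ℕ) {x y : ℕ → QField}
    (hx : ∀ i, x i ∈ vanishing 1) (hy : ∀ i, y i ∈ vanishing 1) :
    HasSum (fun s => chainSum M x s * chainSum N y s)
      (∏ i ∈ Finset.range M, ∏ j ∈ Finset.range N, (1 - x i * y j)⁻¹) := by
  induction M generalizing x with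
  | zero =>
    convert hasSum_single (f := fun s => chainSum 0 x s * chainSum N y s) 0 ?_ using 1
    · simp [chainSum_zero_partSeq]
    · intro s hs
      simp [chainSum, hs]
  | succ M ih =>
    set x' := fun i => x (i + 1) with hx'
    have hf : Summable fun a : PartSeq × PartSeq =>
        (strip (x 0) a.2 a.1 * chainSum M x' a.2) * chainSum N y a.1 := by
      refine summable_strip_mul (g := fun s r => (strip (x 0) r s * chainSum M x' r) *
        chainSum N y s) (c := 0) (fun s u _ => ?_) fun s u h => ?_
      · have h1 := mul_mem_vanishing (strip_mem (hx 0) u s)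
          (chainSum_mem (fun i => hx (i + 1)) M u)
        have h2 := mul_mem_vanishing h1 (chainSum_mem hy N s)
        exact vanishing_anti (by omega) h2
      · simp [strip, h]
    have h1 := hf.hasSum.prod_fiberwise fun s =>
      (hasSum_strip_mul (x 0) (chainSum M x') s).mul_right (chainSum N y s)
    have h2 := (Equiv.prodComm PartSeq PartSeq).hasSum_iff.mpr hf.hasSum
    have h3 := h2.prod_fiberwise fun r => by
      have := (hasSum_strip_mul_chainSum (hx 0) N hy r).mul_left (chainSum M x' r)
      refine this.congr_fun fun s => ?_
      simp only [Function.comp_apply, Equiv.prodComm_apply, Prod.swap_prod_mk]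
      ring
    have h4 := (ih (x := x') fun i => hx (i + 1)).mul_left
      (∏ j ∈ Finset.range N, (1 - x 0 * y j)⁻¹)
    have h5 := h3.unique (h4.congr_fun fun r => by ring)
    rw [h5] at h1
    convert h1 using 1
    · rfl
    rw [Finset.prod_range_succ', mul_comm]

end QField

end ChainSum

/-! ### Interlacing chains and plane partitions -/

namespace QField

/-- Each coefficient of the limit is already attained by some finite partial sum. -/
theorem sub_mem_of_hasSum {ι : Type*} {f g : ι → QField} {a b : QField} {n : ℤ}
    (hf : HasSum f a) (hg : HasSum g b) (h : ∀ i, f i - g i ∈ vanishing n) :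
    a - b ∈ vanishing n := by
  intro d hd
  obtain ⟨s, hs⟩ := (tendsto_coeff (hf.sub hg) d).exists
  rw [← hs]
  exact (vanishing n).sum_mem (fun i _ => h i) d hd

end QField

namespace PartSeq

open QField

section

open scoped Classical

/-- Put `p` in front of the chain `c`. -/
def chainCons (p : PartSeq) (c : ℕ → PartSeq) : ℕ → PartSeq
  | 0 => p
  | k + 1 => c k

theorem chainCons_shift (c : ℕ → PartSeq) : chainCons (c 0) (fun k => c (k + 1)) = c := by
  funext k
  cases k <;> rfl

/-- The interlacing chains `p = p_0 ≻ p_1 ≻ ⋯ ≻ p_N = 0`, continued by `0`. -/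
def chains : ℕ → PartSeq → Finset (ℕ → PartSeq)
  | 0, p => if p = 0 then {fun _ => 0} else ∅
  | N + 1, p => (below p).biUnion fun r => (chains N r).image (chainCons p)

theorem mem_chains {N : ℕ} {p : PartSeq} {c : ℕ → PartSeq} : c ∈ chains N p ↔
    c 0 = p ∧ (∀ k, Interlace (c (k + 1)) (c k)) ∧ ∀ k, N ≤ k → c k = 0 := by
  induction N generalizing p c with
  | zero =>
    unfold chains
    split_ifs with h
    · subst h
      rw [Finset.mem_singleton]
      constructor
      · rintro rfl
        exact ⟨rfl, fun _ => zero_interlace_zero, fun _ _ => rfl⟩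
      · rintro ⟨_, _, h⟩
        exact funext fun k => h k (Nat.zero_le k)
    · simp only [Finset.notMem_empty, false_iff, not_and]
      rintro rfl _ h2
      exact h (h2 0 le_rfl)
  | succ N ih =>
    simp only [chains, Finset.mem_biUnion, Finset.mem_image, mem_below, ih]
    constructor
    · rintro ⟨r, hr, c, ⟨rfl, h1, h2⟩, rfl⟩
      refine ⟨rfl, fun k => ?_, fun k hk => ?_⟩
      · cases k with
        | zero => exact hr
        | succ k => exact h1 k
      · cases k with
        | zero => omega
        | succ k => exact h2 k (by omega)
    · rintro ⟨rfl, h1, h2⟩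
      exact ⟨c 1, h1 0, fun k => c (k + 1), ⟨rfl, fun k => h1 (k + 1), fun k hk => h2 _ (by omega)⟩,
        chainCons_shift c⟩

theorem chainSum_eq_sum_chains {K : Type*} [Field K] (N : ℕ) (u : ℕ → K) (p : PartSeq) :
    chainSum N u p =
      ∑ c ∈ chains N p, ∏ k ∈ Finset.range N, u k ^ ((c k).size - (c (k + 1)).size) := by
  induction N generalizing u p with
  | zero =>
    unfold chainSum chains
    split_ifs <;> simp
  | succ N ih =>
    unfold chainSum chains
    rw [Finset.sum_biUnion]
    · refine Finset.sum_congr rfl fun r hr => ?_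
      rw [Finset.sum_image, ih, Finset.mul_sum]
      · refine Finset.sum_congr rfl fun c hc => ?_
        rw [Finset.prod_range_succ', mul_comm, strip_of_mem hr, ← (mem_chains.mp hc).1]
        rfl
      · intro c _ d _ h
        exact funext fun k => congrFun h (k + 1)
    · intro r _ s _ hrs
      refine Finset.disjoint_left.mpr fun c hc hd => hrs ?_
      simp only [Finset.mem_image, mem_chains] at hc hd
      obtain ⟨c, ⟨rfl, _⟩, rfl⟩ := hc
      obtain ⟨d, ⟨rfl, _⟩, h⟩ := hd
      exact (congrFun h 1).symm

end

/-- The interlacing chains `p = p_0 ≻ p_1 ≻ ⋯` that are eventually `0`. -/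
@[ext]
structure Chain (p : PartSeq) where
  seq : ℕ → PartSeq
  start : seq 0 = p
  interlace : ∀ k, Interlace (seq (k + 1)) (seq k)
  eventually_zero : ∃ N, ∀ k, N ≤ k → seq k = 0

namespace Chain

variable {p : PartSeq}

/-- The exponent of `q^{1/2}` in the contribution of a chain. -/
def weight (c : Chain p) : ℕ := p.size + 2 * ∑ᶠ k, (c.seq (k + 1)).size

theorem weight_eq (c : Chain p) {N : ℕ} (h : ∀ k, N ≤ k → c.seq k = 0) :
    c.weight = p.size + 2 * ∑ k ∈ Finset.range N, (c.seq (k + 1)).size := by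
  rw [weight, finsum_eq_finsetSum_of_support_subset]
  intro k hk
  simp only [Finset.coe_range, Set.mem_Iio]
  by_contra hc
  exact hk (by simp [h (k + 1) (by omega)])

/-- The sizes decrease along the chain, so `seq 0, …, seq k` are all nonempty; the first contributes
at least `1` and the other `k` at least `2` each. Hence a chain of small weight is short. -/
theorem lt_weight (c : Chain p) {k : ℕ} (hk : c.seq k ≠ 0) : k < c.weight := by
  obtain ⟨N, hN⟩ := c.eventually_zero
  have hkN : k < N := by
    by_contra hc
    exact hk (hN k (not_lt.mp hc))
  have hanti : Antitone fun i => (c.seq i).size := antitone_nat_of_succ_le fun i => (c.interlace i).size_le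
  have hpos : ∀ i ≤ k, 1 ≤ (c.seq i).size := fun i hi =>
    (Nat.one_le_iff_ne_zero.mpr fun h => hk (size_eq_zero_iff.mp h)).trans (hanti hi)
  have h0 := hpos 0 (Nat.zero_le k)
  rw [c.start] at h0
  have h1 : k ≤ ∑ i ∈ Finset.range N, (c.seq (i + 1)).size := by
    calc k = ∑ i ∈ Finset.range k, 1 := by simp
      _ ≤ ∑ i ∈ Finset.range k, (c.seq (i + 1)).size :=
        Finset.sum_le_sum fun i hi => hpos _ (Finset.mem_range.mp hi)
      _ ≤ _ := Finset.sum_le_sum_of_subset (Finset.range_mono hkN.le)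
  rw [c.weight_eq hN]
  omega

/-- Abel summation: consecutive odd numbers differ by `2`, so every term after the first is counted
twice. This is where the exponents `1/2, 3/2, …` become box counts. -/
theorem sum_range_eq_weight (c : Chain p) {N : ℕ} (h : ∀ k, N ≤ k → c.seq k = 0) :
    ∑ k ∈ Finset.range N, (2 * k + 1) * ((c.seq k).size - (c.seq (k + 1)).size) = c.weight := by
  have key : ∀ N, ∑ k ∈ Finset.range N, (2 * k + 1) * ((c.seq k).size - (c.seq (k + 1)).size) +
      (2 * N + 1) * (c.seq N).size = (c.seq 0).size + 2 * ∑ k ∈ Finset.range N, (c.seq (k + 1)).size := by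
    intro N
    induction N with
    | zero => simp
    | succ N ih =>
      obtain ⟨m, hm⟩ := Nat.exists_eq_add_of_le (c.interlace N).size_le
      rw [Finset.sum_range_succ, Finset.sum_range_succ, mul_add 2 (Finset.sum _ _),
        ← add_assoc (PartSeq.size _), ← ih, hm, Nat.add_sub_cancel_left]
      ring
  have := key N
  rw [h N le_rfl, size_zero, mul_zero, add_zero, c.start] at this
  rw [this, c.weight_eq h]

theorem prod_eq_sqrtQ_pow (c : Chain p) {N : ℕ} (h : ∀ k, N ≤ k → c.seq k = 0) :
    ∏ k ∈ Finset.range N, (sqrtQ ^ (2 * k + 1)) ^ ((c.seq k).size - (c.seq (k + 1)).size) =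
      sqrtQ ^ c.weight := by
  simp_rw [← pow_mul, Finset.prod_pow_eq_pow_sum, c.sum_range_eq_weight h]

/-- The chain reaches `0` after at most `N` steps. -/
def Short (N : ℕ) (c : Chain p) : Prop := ∀ k, N ≤ k → c.seq k = 0

theorem le_weight_of_not_short {N : ℕ} {c : Chain p} (h : ¬ c.Short N) : N ≤ c.weight := by
  simp only [Short, not_forall] at h
  obtain ⟨k, hk, hc⟩ := h
  exact hk.trans (c.lt_weight hc).le

theorem finite_short (N : ℕ) : {c : Chain p | c.Short N}.Finite := by
  refine Set.Finite.of_finite_image (f := Chain.seq)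
    ((chains N p).finite_toSet.subset ?_) (fun c _ d _ h => Chain.ext h)
  rintro _ ⟨c, hc, rfl⟩
  exact mem_chains.mpr ⟨c.start, c.interlace, hc⟩

-- Writes the truncated chain sum as a sum over the fixed type `Chain p`, so that truncations of
-- different lengths can be compared term by term.
open scoped Classical in
theorem hasSum_short (N : ℕ) : HasSum (fun c : Chain p => if c.Short N then sqrtQ ^ c.weight else 0)
    (chainSum N (fun k => sqrtQ ^ (2 * k + 1)) p) := by
  have h : chainSum N (fun k => sqrtQ ^ (2 * k + 1)) p =
      ∑ c ∈ (finite_short (p := p) N).toFinset, if c.Short N then sqrtQ ^ c.weight else 0 := by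
    rw [chainSum_eq_sum_chains]
    symm
    refine Finset.sum_bij (fun c _ => c.seq) ?_ ?_ ?_ ?_
    · intro c hc
      exact mem_chains.mpr ⟨c.start, c.interlace, (finite_short N).mem_toFinset.mp hc⟩
    · intro c _ d _ h
      exact Chain.ext h
    · intro c hc
      obtain ⟨h1, h2, h3⟩ := mem_chains.mp hc
      exact ⟨⟨c, h1, h2, N, h3⟩, (finite_short N).mem_toFinset.mpr h3, rfl⟩
    · intro c hc
      have hs : c.Short N := (finite_short N).mem_toFinset.mp hc
      rw [if_pos hs, c.prod_eq_sqrtQ_pow hs]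
  rw [h]
  refine hasSum_sum_of_ne_finset_zero fun c hc => if_neg ?_
  simpa using hc

theorem summable_weight : Summable fun c : Chain p => sqrtQ ^ c.weight := by
  refine summable_sqrtQ_pow fun n => (finite_short (n + 1)).subset fun c hc => ?_
  by_contra h
  have := le_weight_of_not_short h
  rw [Set.mem_ofPred_eq] at hc
  omega

open scoped Classical in
theorem ite_short_sub_mem (N : ℕ) (c : Chain p) :
    (if c.Short N then sqrtQ ^ c.weight else 0) - sqrtQ ^ c.weight ∈ vanishing N := by
  split_ifs with h
  · rw [sub_self]
    exact AddSubgroup.zero_mem _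
  · rw [zero_sub]
    exact AddSubgroup.neg_mem _ (sqrtQ_pow_mem (by exact_mod_cast le_weight_of_not_short h))

theorem tendsto_chainSum (p : PartSeq) :
    Tendsto (fun N => chainSum N (fun k => sqrtQ ^ (2 * k + 1)) p) atTop
      (𝓝 (∑' c : Chain p, sqrtQ ^ c.weight)) := by
  refine tendsto_of_sub_mem fun n => (eventually_ge_atTop n).mono fun N hN => ?_
  exact vanishing_anti (by exact_mod_cast hN)
    (sub_mem_of_hasSum (hasSum_short N) summable_weight.hasSum (ite_short_sub_mem N))

end Chain

end PartSeq

namespace PlanePartition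

open PartSeq QField

theorem height_anti (π : PlanePartition) {i i' j j' : ℕ} (hi : i ≤ i') (hj : j ≤ j') :
    π.height i' j' ≤ π.height i j :=
  (antitone_nat_of_succ_le (f := fun i => π.height i j') (fun i => π.antitone_fst i j') hi).trans
    (antitone_nat_of_succ_le (f := fun j => π.height i j) (π.antitone_snd i) hj)

theorem exists_box (π : PlanePartition) : ∃ N, ∀ k, N ≤ k → π.height k 0 = 0 ∧ π.height 0 k = 0 := by
  have h1 := π.tendsto_fst 0
  have h2 := π.tendsto_snd 0
  rw [nhds_discrete, tendsto_pure] at h1 h2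
  exact eventually_atTop.mp (h1.and h2)

theorem eq_zero_of_box {π : PlanePartition} {N i j : ℕ}
    (hN : ∀ k, N ≤ k → π.height k 0 = 0 ∧ π.height 0 k = 0) (h : N ≤ i ∨ N ≤ j) :
    π.height i j = 0 := by
  rcases h with h | h
  · exact Nat.le_zero.mp ((hN i h).1 ▸ π.height_anti le_rfl (Nat.zero_le j))
  · exact Nat.le_zero.mp ((hN j h).2 ▸ π.height_anti (Nat.zero_le i) le_rfl)

/-- The `k`-th diagonal below the main one. -/
def lower (π : PlanePartition) (k : ℕ) : PartSeq where
  part i := π.height (i + k) i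
  anti _ _ h := π.height_anti (by omega) h
  eventually_zero := by
    obtain ⟨N, hN⟩ := π.exists_box
    exact ⟨N, fun i hi => eq_zero_of_box hN (Or.inr hi)⟩

/-- The `k`-th diagonal above the main one. -/
def upper (π : PlanePartition) (k : ℕ) : PartSeq where
  part i := π.height i (i + k)
  anti _ _ h := π.height_anti h (by omega)
  eventually_zero := by
    obtain ⟨N, hN⟩ := π.exists_box
    exact ⟨N, fun i hi => eq_zero_of_box hN (Or.inl hi)⟩

/-- A plane partition consists of two chains of diagonals that start at the main diagonal. -/
def diagonalsEquiv (p : PartSeq) : {π : PlanePartition // π.lower 0 = p} ≃ Chain p × Chain p where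
  toFun π :=
    (⟨π.1.lower, π.2, fun k i => ⟨π.1.height_anti (by omega) le_rfl,
        π.1.height_anti (by omega) (by omega)⟩, by
      obtain ⟨N, hN⟩ := π.1.exists_box
      exact ⟨N, fun k hk => eq_zero_of_part_zero (eq_zero_of_box hN (Or.inl (by omega)))⟩⟩,
    ⟨π.1.upper, π.2, fun k i => ⟨π.1.height_anti le_rfl (by omega),
        π.1.height_anti (by omega) (by omega)⟩, by
      obtain ⟨N, hN⟩ := π.1.exists_box
      exact ⟨N, fun k hk => eq_zero_of_part_zero (eq_zero_of_box hN (Or.inr (by omega)))⟩⟩)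
  invFun x := ⟨{
      height := fun i j => if j ≤ i then (x.1.seq (i - j)).part j else (x.2.seq (j - i)).part i
      antitone_fst := fun i j => by
        have hc := x.1.interlace (i - j) j
        have hd := x.2.interlace (j - (i + 1)) i
        rcases lt_trichotomy (i + 1) j with h | h | h
        · rw [if_neg (by omega), if_neg (by omega), show j - i = j - (i + 1) + 1 by omega]
          exact hd.2
        · subst h
          rw [if_pos le_rfl, if_neg (by omega), Nat.sub_self,
            x.1.start.trans x.2.start.symm]
          simpa using hd.2
        · rw [if_pos (by omega), if_pos (by omega), show i + 1 - j = i - j + 1 by omega]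
          exact hc.1
      antitone_snd := fun i j => by
        have hc := x.1.interlace (i - (j + 1)) j
        have hd := x.2.interlace (j - i) i
        rcases lt_trichotomy i j with h | h | h
        · rw [if_neg (by omega), if_neg (by omega), show j + 1 - i = j - i + 1 by omega]
          exact hd.1
        · subst h
          rw [if_neg (by omega), if_pos le_rfl, Nat.sub_self,
            x.1.start.trans x.2.start.symm]
          simpa using hd.1
        · rw [if_pos (by omega), if_pos (by omega), show i - j = i - (j + 1) + 1 by omega]
          exact hc.2
      tendsto_fst := fun j => by
        obtain ⟨N, hN⟩ := x.1.eventually_zero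
        rw [nhds_discrete, tendsto_pure]
        filter_upwards [eventually_ge_atTop (N + j)] with i hi
        rw [if_pos (by omega), hN _ (by omega), zero_part]
      tendsto_snd := fun i => by
        obtain ⟨N, hN⟩ := x.2.eventually_zero
        rw [nhds_discrete, tendsto_pure]
        filter_upwards [eventually_ge_atTop (N + i + 1)] with j hj
        rw [if_neg (by omega), hN _ (by omega), zero_part] }, by
    ext i
    simp [lower, x.1.start]⟩
  left_inv := by
    rintro ⟨⟨h, h1, h2, h3, h4⟩, hp⟩
    simp only [Subtype.mk.injEq, PlanePartition.mk.injEq]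
    funext i j
    split_ifs with hij
    · simp [lower, Nat.add_sub_cancel' hij]
    · simp [upper, Nat.add_sub_cancel' (not_le.mp hij).le]
  right_inv x := by
    refine Prod.ext (Chain.ext (funext fun k => PartSeq.ext (funext fun i => ?_)))
      (Chain.ext (funext fun k => PartSeq.ext (funext fun i => ?_)))
    · simp [lower]
    · rcases Nat.eq_zero_or_pos k with rfl | hk
      · simp [upper, x.1.start, x.2.start]
      · simp only [upper]
        rw [if_neg (by omega), Nat.add_sub_cancel_left]

theorem size_eq_sum (π : PlanePartition) {N : ℕ}
    (hN : ∀ k, N ≤ k → π.height k 0 = 0 ∧ π.height 0 k = 0) :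
    π.size = ∑ x ∈ Finset.range N ×ˢ Finset.range N, π.height x.1 x.2 := by
  refine finsum_eq_finsetSum_of_support_subset _ fun x hx => ?_
  simp only [Finset.coe_product, Finset.coe_range, Set.mem_prod, Set.mem_Iio]
  by_contra hc
  exact hx (eq_zero_of_box hN (by omega))

/-- The main diagonal appears once in each of the two weights, and every other diagonal twice in one
of them. -/
theorem two_mul_size {p : PartSeq} (π : {π : PlanePartition // π.lower 0 = p}) :
    2 * π.1.size = (diagonalsEquiv p π).1.weight + (diagonalsEquiv p π).2.weight := by
  obtain ⟨π, rfl⟩ := π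
  obtain ⟨N, hN⟩ := π.exists_box
  have hl : ∀ k, (π.lower k).size = ∑ i ∈ Finset.range N, π.height (i + k) i := fun k =>
    PartSeq.size_eq_sum _ fun i hi => eq_zero_of_box hN (Or.inr hi)
  have hu : ∀ k, (π.upper k).size = ∑ i ∈ Finset.range N, π.height i (i + k) := fun k =>
    PartSeq.size_eq_sum _ fun i hi => eq_zero_of_box hN (Or.inl hi)
  rw [Chain.weight_eq (N := N), Chain.weight_eq (N := N)]
  rotate_left
  · exact fun k hk => eq_zero_of_part_zero (eq_zero_of_box hN (Or.inr (by omega)))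
  · exact fun k hk => eq_zero_of_part_zero (eq_zero_of_box hN (Or.inl (by omega)))
  change _ = (π.lower 0).size + 2 * ∑ k ∈ Finset.range N, (π.lower (k + 1)).size +
    ((π.lower 0).size + 2 * ∑ k ∈ Finset.range N, (π.upper (k + 1)).size)
  simp_rw [hl, hu, ← Finset.sum_product']
  -- The box is split into the cells below, above and on the main diagonal, with off-diagonal cells
  -- indexed by the distance `k + 1` from the diagonal and the position along it.
  have h1 : ∑ x ∈ Finset.range N ×ˢ Finset.range N with x.2 < x.1, π.height x.1 x.2 =
      ∑ x ∈ Finset.range N ×ˢ Finset.range N, π.height (x.2 + (x.1 + 1)) x.2 := by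
    refine Finset.sum_of_injOn (fun x => (x.1 - x.2 - 1, x.2)) ?_ ?_ ?_ ?_
    · rintro ⟨a, b⟩ hx ⟨a', b'⟩ hy h
      simp only [Finset.coe_filter, Finset.mem_product, Finset.mem_range, Set.mem_ofPred_eq,
        Prod.mk.injEq] at hx hy h ⊢
      omega
    · rintro ⟨a, b⟩ hx
      simp only [Finset.coe_filter, Finset.mem_product, Finset.mem_range, Set.mem_ofPred_eq,
        Finset.coe_product, Finset.coe_range, Set.mem_prod, Set.mem_Iio] at hx ⊢
      omega
    · rintro ⟨k, i⟩ hx hni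
      by_contra hc
      -- The cell `(i + k + 1, i)` may leave the box, but then its height is zero.
      refine hni ⟨(i + (k + 1), i), ?_, ?_⟩
      · simp only [Finset.coe_filter, Finset.mem_product, Finset.mem_range, Set.mem_ofPred_eq] at hx ⊢
        refine ⟨⟨?_, hx.2⟩, by omega⟩
        by_contra hge
        exact hc (eq_zero_of_box hN (Or.inl (not_lt.mp hge)))
      · simp only [Prod.mk.injEq, and_true]
        omega
    · rintro ⟨a, b⟩ hx
      simp only [Finset.mem_filter] at hx
      dsimp only
      congr 1
      omega
  have h2 : ∑ x ∈ Finset.range N ×ˢ Finset.range N with ¬ x.2 < x.1 ∧ x.1 < x.2,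
      π.height x.1 x.2 = ∑ x ∈ Finset.range N ×ˢ Finset.range N, π.height x.2 (x.2 + (x.1 + 1)) := by
    refine Finset.sum_of_injOn (fun x => (x.2 - x.1 - 1, x.1)) ?_ ?_ ?_ ?_
    · rintro ⟨a, b⟩ hx ⟨a', b'⟩ hy h
      simp only [Finset.coe_filter, Finset.mem_product, Finset.mem_range, Set.mem_ofPred_eq,
        Prod.mk.injEq] at hx hy h ⊢
      omega
    · rintro ⟨a, b⟩ hx
      simp only [Finset.coe_filter, Finset.mem_product, Finset.mem_range, Set.mem_ofPred_eq,
        Finset.coe_product, Finset.coe_range, Set.mem_prod, Set.mem_Iio] at hx ⊢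
      omega
    · rintro ⟨k, i⟩ hx hni
      by_contra hc
      refine hni ⟨(i, i + (k + 1)), ?_, ?_⟩
      · simp only [Finset.coe_filter, Finset.mem_product, Finset.mem_range, Set.mem_ofPred_eq] at hx ⊢
        refine ⟨⟨hx.2, ?_⟩, by omega, by omega⟩
        by_contra hge
        exact hc (eq_zero_of_box hN (Or.inr (not_lt.mp hge)))
      · simp only [Prod.mk.injEq, and_true]
        omega
    · rintro ⟨a, b⟩ hx
      simp only [Finset.mem_filter] at hx
      dsimp only
      congr 1
      omega
  have h3 : ∑ x ∈ Finset.range N ×ˢ Finset.range N with ¬ x.2 < x.1 ∧ ¬ x.1 < x.2,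
      π.height x.1 x.2 = ∑ i ∈ Finset.range N, π.height (i + 0) i := by
    refine Finset.sum_bij' (fun x _ => x.1) (fun i _ => (i, i)) ?_ ?_ ?_ ?_ ?_
    · rintro ⟨a, b⟩ hx
      simp only [Finset.mem_filter, Finset.mem_product] at hx
      exact hx.1.1
    · intro i hi
      simpa using hi
    · rintro ⟨a, b⟩ hx
      simp only [Finset.mem_filter] at hx
      obtain rfl : a = b := by omega
      rfl
    · intros
      rfl
    · rintro ⟨a, b⟩ hx
      simp only [Finset.mem_filter] at hx
      obtain rfl : a = b := by omega
      rfl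
  rw [π.size_eq_sum hN, ← Finset.sum_filter_add_sum_filter_not _ (fun x : ℕ × ℕ => x.2 < x.1), h1,
    ← Finset.sum_filter_add_sum_filter_not (Finset.filter _ _) (fun x : ℕ × ℕ => x.1 < x.2),
    Finset.filter_filter, Finset.filter_filter, h2, h3]
  ring

end PlanePartition

/-! ### The generating function of plane partitions -/

namespace PlanePartition

open PartSeq QField

theorem qVar_pow (n : ℕ) : qVar ^ n = sqrtQ ^ (2 * n) := (pow_mul _ _ _).symm

/-- The contribution of the chains that start at `p` to the correlation function. -/
def halfSum (p : PartSeq) : QField := ∑' c : Chain p, sqrtQ ^ c.weight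

theorem finite_two_mul_size_eq (n : ℕ) : {π : PlanePartition | 2 * π.size = n}.Finite := by
  refine ((finite_size_le n).biUnion fun p _ =>
    (((Chain.finite_short (p := p) (n + 1)).prod (Chain.finite_short (p := p) (n + 1))).image
      fun x => ((diagonalsEquiv p).symm x).1)).subset fun π hπ => ?_
  have h := two_mul_size (⟨π, rfl⟩ : {π' : PlanePartition // π'.lower 0 = π.lower 0})
  replace hπ : 2 * π.size = n := hπ
  dsimp only at h
  simp only [Set.mem_iUnion]
  refine ⟨π.lower 0, ?_, diagonalsEquiv _ ⟨π, rfl⟩, ⟨?_, ?_⟩, by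
    simp only [Equiv.symm_apply_apply]⟩
  · rw [Set.mem_ofPred_eq]
    have : (π.lower 0).size ≤ (diagonalsEquiv _ ⟨π, rfl⟩).1.weight := Nat.le_add_right _ _
    omega
  all_goals
    by_contra hc
    have := Chain.le_weight_of_not_short hc
    omega

theorem summable_size : Summable fun π : PlanePartition => qVar ^ π.size := by
  simp_rw [qVar_pow]
  exact summable_sqrtQ_pow finite_two_mul_size_eq

/-- Summation over plane partitions, grouped by the main diagonal. -/
theorem hasSum_of_fiberwise {f : PlanePartition → QField} (hf : Summable f)
    {g : ∀ p, Chain p → QField} {s : PartSeq → QField} (hg : ∀ p, HasSum (g p) (s p))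
    (h : ∀ p (π : {π : PlanePartition // π.lower 0 = p}),
      f π.1 = g p (diagonalsEquiv p π).1 * g p (diagonalsEquiv p π).2) :
    HasSum (fun p => s p * s p) (∑' π, f π) := by
  have h1 := (Equiv.sigmaFiberEquiv fun π : PlanePartition => π.lower 0).hasSum_iff.mpr hf.hasSum
  refine h1.sigma fun p => ?_
  have h2 := (diagonalsEquiv p).hasSum_iff.mpr ((hg p).mul_of_nonarchimedean (hg p))
  exact h2.congr_fun fun π => h p π

theorem hasSum_halfSum_mul : HasSum (fun p => halfSum p * halfSum p)
    (∑' π : PlanePartition, qVar ^ π.size) :=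
  hasSum_of_fiberwise summable_size (fun _ => Chain.summable_weight.hasSum) fun p π => by
    rw [qVar_pow, two_mul_size, pow_add]

theorem sqrtQ_pow_odd_mem (i : ℕ) : sqrtQ ^ (2 * i + 1) ∈ vanishing 1 :=
  sqrtQ_pow_mem (by push_cast; omega)

-- By the Cauchy identity the finite product counts the plane partitions both of whose chains have
-- length at most `N`. Every other plane partition has a chain that is not short, hence of weight at
-- least `N`.
open scoped Classical in
theorem prod_sub_tsum_mem (N : ℕ) :
    (∏ i ∈ Finset.range N, ∏ j ∈ Finset.range N, (1 - sqrtQ ^ (2 * i + 1) * sqrtQ ^ (2 * j + 1))⁻¹)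
      - ∑' π : PlanePartition, qVar ^ π.size ∈ vanishing N := by
  let g : ∀ p, Chain p → QField := fun p c => if c.Short N then sqrtQ ^ c.weight else 0
  let S : Set PlanePartition := {π | (diagonalsEquiv _ ⟨π, rfl⟩).1.Short N ∧
    (diagonalsEquiv (π.lower 0) ⟨π, rfl⟩).2.Short N}
  have hS : Summable (S.indicator fun π => qVar ^ π.size) := summable_size.indicator S
  have h1 := hasSum_of_fiberwise hS (g := g) (fun p => Chain.hasSum_short N) fun p π => by
    obtain ⟨π, rfl⟩ := π
    simp only [Set.indicator_apply, S, Set.mem_ofPred_eq, g]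
    rw [qVar_pow, two_mul_size ⟨π, rfl⟩, pow_add]
    split_ifs <;> simp_all
  rw [← h1.unique (hasSum_chainSum_mul_chainSum N N sqrtQ_pow_odd_mem sqrtQ_pow_odd_mem)]
  refine sub_mem_of_hasSum hS.hasSum summable_size.hasSum fun π => ?_
  by_cases h : π ∈ S
  · rw [Set.indicator_of_mem h, sub_self]
    exact AddSubgroup.zero_mem _
  · rw [Set.indicator_of_notMem h, zero_sub, qVar_pow]
    refine AddSubgroup.neg_mem _ (sqrtQ_pow_mem ?_)
    have h2 := two_mul_size (⟨π, rfl⟩ : {π' : PlanePartition // π'.lower 0 = π.lower 0})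
    rw [h2]
    rcases not_and_or.mp h with h | h
    all_goals
      have := Chain.le_weight_of_not_short h
      push_cast
      omega

end PlanePartition

/-! ### MacMahon's product -/

namespace QField

/-- The Laurent series congruent to `1` up to order `n`. -/
def oneUnits (n : ℕ) : Submonoid QField where
  carrier := {f | f - 1 ∈ vanishing n}
  one_mem' := by simp
  mul_mem' {a b} ha hb := by
    have hb0 : b ∈ vanishing 0 := by
      simpa using AddSubgroup.add_mem _ (vanishing_anti (by omega) hb) one_mem_vanishing
    have := AddSubgroup.add_mem _ (mul_mem_vanishing_left ha hb0) hb
    rwa [show (a - 1) * b + (b - 1) = a * b - 1 by ring] at this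

theorem mem_oneUnits {n : ℕ} {f : QField} : f ∈ oneUnits n ↔ f - 1 ∈ vanishing n := Iff.rfl

theorem oneUnits_le_vanishing {n : ℕ} {f : QField} (h : f ∈ oneUnits n) : f ∈ vanishing 0 := by
  simpa using AddSubgroup.add_mem _ (vanishing_anti (by omega) h) one_mem_vanishing

theorem inv_one_sub_qVar_pow_mem {n k : ℕ} (h : n ≤ k + 1) :
    (1 - qVar ^ (k + 1))⁻¹ ∈ oneUnits n := by
  have h1 : qVar ^ (k + 1) ∈ vanishing ((k : ℕ) + 1) := by
    rw [PlanePartition.qVar_pow]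
    exact sqrtQ_pow_mem (by push_cast; omega)
  exact vanishing_anti (by exact_mod_cast h) (inv_one_sub_mem h1).1

/-- For `k < n` the whole antidiagonal `i + j = k`, with its `k + 1` points, lies in the box. -/
theorem prod_box_eq (n : ℕ) (g : ℕ → QField) :
    ∏ x ∈ Finset.range n ×ˢ Finset.range n with x.1 + x.2 < n, g (x.1 + x.2) =
      ∏ k ∈ Finset.range n, g k ^ (k + 1) := by
  rw [← Finset.prod_fiberwise_of_maps_to (t := Finset.range n) (g := fun x : ℕ × ℕ => x.1 + x.2)
    fun x hx => Finset.mem_range.mpr (Finset.mem_filter.mp hx).2]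
  refine Finset.prod_congr rfl fun k hk => ?_
  rw [Finset.prod_congr rfl fun x hx => congrArg g (Finset.mem_filter.mp hx).2, Finset.prod_const,
    ← Finset.Nat.card_antidiagonal k]
  congr 2
  ext x
  simp only [Finset.mem_filter, Finset.mem_product, Finset.mem_range,
    Finset.HasAntidiagonal.mem_antidiagonal] at hk ⊢
  omega

theorem hasProd_macMahon : HasProd (fun n : ℕ => (1 / (1 - qVar ^ (n + 1))) ^ (n + 1))
    (∑' π : PlanePartition, qVar ^ π.size) := by
  refine tendsto_of_sub_mem fun n => ?_
  -- Once `F` contains `range n`, the product over `F` and the box product share the factors of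
  -- index below `n`; all other factors on either side are congruent to `1` up to order `n`.
  have hev : ∀ᶠ F : Finset ℕ in (SummationFilter.unconditional ℕ).filter, Finset.range n ⊆ F := by
    rw [SummationFilter.unconditional_filter]
    exact eventually_ge_atTop _
  refine hev.mono fun F hF => ?_
  set g : ℕ → QField := fun k => (1 - qVar ^ (k + 1))⁻¹ with hg
  have h1 := PlanePartition.prod_sub_tsum_mem n
  have h2 : (∏ i ∈ Finset.range n, ∏ j ∈ Finset.range n,
      (1 - sqrtQ ^ (2 * i + 1) * sqrtQ ^ (2 * j + 1))⁻¹) =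
      (∏ k ∈ Finset.range n, g k ^ (k + 1)) *
        ∏ x ∈ Finset.range n ×ˢ Finset.range n with ¬ x.1 + x.2 < n, g (x.1 + x.2) := by
    rw [← prod_box_eq, Finset.prod_filter_mul_prod_filter_not, Finset.prod_product]
    refine Finset.prod_congr rfl fun i _ => Finset.prod_congr rfl fun j _ => ?_
    simp only [hg]
    rw [← pow_add, PlanePartition.qVar_pow, show 2 * i + 1 + (2 * j + 1) = 2 * (i + j + 1) by ring]
  have h3 : ∏ n ∈ F, (1 / (1 - qVar ^ (n + 1))) ^ (n + 1) =
      (∏ k ∈ Finset.range n, g k ^ (k + 1)) * ∏ k ∈ F \ Finset.range n, g k ^ (k + 1) := by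
    rw [mul_comm, Finset.prod_sdiff hF]
    simp_rw [hg, one_div]
  have hA : ∏ k ∈ Finset.range n, g k ^ (k + 1) ∈ oneUnits 0 :=
    Submonoid.prod_mem _ fun k _ => Submonoid.pow_mem _ (inv_one_sub_qVar_pow_mem (by omega)) _
  have hu : ∏ k ∈ F \ Finset.range n, g k ^ (k + 1) ∈ oneUnits n :=
    Submonoid.prod_mem _ fun k hk => by
      simp only [Finset.mem_sdiff, Finset.mem_range] at hk
      exact Submonoid.pow_mem _ (inv_one_sub_qVar_pow_mem (by omega)) _
  have hv : ∏ x ∈ Finset.range n ×ˢ Finset.range n with ¬ x.1 + x.2 < n, g (x.1 + x.2) ∈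
      oneUnits n := Submonoid.prod_mem _ fun x hx => by
    simp only [Finset.mem_filter] at hx
    exact inv_one_sub_qVar_pow_mem (by omega)
  have h4 := mul_mem_vanishing_left (AddSubgroup.sub_mem _ (mem_oneUnits.mp hu) (mem_oneUnits.mp hv))
    (oneUnits_le_vanishing hA)
  have h5 := AddSubgroup.add_mem _ h4 h1
  rw [h2] at h5
  rw [h3]
  convert h5 using 1
  ring

end QField

/-! ### Fermions and the Heisenberg operators -/

namespace Maya

theorem ext_black {s t : Maya} (h : s.black = t.black) : s = t := by
  cases s
  cases t
  congr

/-- The number of black stones to the left of the site `m`. -/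
def count (s : Maya) (m : ℤ) : ℕ := Set.ncard {j | j ∈ s.black ∧ j < m}

theorem finite_lt (s : Maya) (m : ℤ) : {j | j ∈ s.black ∧ j < m}.Finite := by
  obtain ⟨N, _, h⟩ := s.finite_energy
  refine (Set.finite_Ioo (-N) m).subset fun j hj => ⟨?_, hj.2⟩
  by_contra hc
  exact h j (not_lt.mp hc) hj.1

theorem count_putBlack_of_lt {s : Maya} {a b : ℤ} (ha : a ∉ s.black) (h : a < b) :
    (s.putBlack a).count b = s.count b + 1 := by
  have : {j | j ∈ (s.putBlack a).black ∧ j < b} = insert a {j | j ∈ s.black ∧ j < b} := by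
    ext j
    simp only [putBlack, Set.mem_insert_iff, Set.mem_ofPred_eq]
    constructor
    · rintro ⟨rfl | hj, hb⟩
      · exact Or.inl rfl
      · exact Or.inr ⟨hj, hb⟩
    · rintro (rfl | hj)
      · exact ⟨Or.inl rfl, h⟩
      · exact ⟨Or.inr hj.1, hj.2⟩
  rw [count, this, Set.ncard_insert_of_notMem (fun hc => ha hc.1) (s.finite_lt b)]
  rfl

theorem count_putBlack_of_le {s : Maya} {a b : ℤ} (h : b ≤ a) :
    (s.putBlack a).count b = s.count b := by
  unfold count
  congr 1
  ext j
  simp only [putBlack, Set.mem_insert_iff, Set.mem_ofPred_eq]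
  constructor
  · rintro ⟨rfl | hj, hb⟩
    · omega
    · exact ⟨hj, hb⟩
  · exact fun hj => ⟨Or.inr hj.1, hj.2⟩

theorem putBlack_putWhite {s : Maya} {a : ℤ} (h : a ∈ s.black) :
    (s.putWhite a).putBlack a = s := by
  apply ext_black
  simp [putBlack, putWhite, Set.insert_eq_of_mem h]

theorem putWhite_putBlack {s : Maya} {a : ℤ} (h : a ∉ s.black) :
    (s.putBlack a).putWhite a = s := by
  apply ext_black
  simp [putBlack, putWhite, h]

theorem notMem_putWhite (s : Maya) (a : ℤ) : a ∉ (s.putWhite a).black := by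
  simp [putWhite]

theorem mem_putBlack (s : Maya) (a : ℤ) : a ∈ (s.putBlack a).black := by
  simp [putBlack]

theorem mem_putBlack_of_ne {s : Maya} {a b : ℤ} (h : b ≠ a) :
    b ∈ (s.putBlack a).black ↔ b ∈ s.black := by
  simp [putBlack, h]

theorem mem_putWhite_of_ne {s : Maya} {a b : ℤ} (h : b ≠ a) :
    b ∈ (s.putWhite a).black ↔ b ∈ s.black := by
  simp [putWhite, h]

theorem count_putWhite_of_lt {s : Maya} {a b : ℤ} (ha : a ∈ s.black) (h : a < b) :
    s.count b = (s.putWhite a).count b + 1 := by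
  rw [← count_putBlack_of_lt (s.notMem_putWhite a) h, putBlack_putWhite ha]

theorem count_putWhite_of_le {s : Maya} {a b : ℤ} (ha : a ∈ s.black) (h : b ≤ a) :
    (s.putWhite a).count b = s.count b := by
  rw [← count_putBlack_of_le (s := s.putWhite a) h, putBlack_putWhite ha]

theorem putBlack_comm (s : Maya) (a b : ℤ) :
    (s.putBlack a).putBlack b = (s.putBlack b).putBlack a :=
  ext_black (Set.insert_comm _ _ _)

theorem putWhite_putBlack_comm {s : Maya} {a b : ℤ} (h : a ≠ b) :
    (s.putBlack b).putWhite a = (s.putWhite a).putBlack b := by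
  apply ext_black
  ext j
  simp only [putBlack, putWhite, Set.mem_sdiff, Set.mem_insert_iff, Set.mem_singleton_iff]
  constructor
  · rintro ⟨rfl | hj, h'⟩
    · exact Or.inl rfl
    · exact Or.inr ⟨hj, h'⟩
  · rintro (rfl | hj)
    · exact ⟨Or.inl rfl, Ne.symm h⟩
    · exact ⟨Or.inr hj.1, hj.2⟩

end Maya

section Heisenberg

variable (K : Type) [Field K]

theorem linearMap_ext_ket {M : Type*} [AddCommGroup M] [Module K M] {f g : InitialFock K →ₗ[K] M}
    (h : ∀ s, f (ket K s) = g (ket K s)) : f = g :=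
  Finsupp.lhom_ext' fun s => LinearMap.ext_ring (h s)

section

open scoped Classical

theorem psi_ket (m : ℤ) (s : Maya) : psi K m (ket K s) =
    if m ∈ s.black then (-1 : K) ^ s.count m • ket K (s.putWhite m) else 0 := by
  simp [psi, ket, Maya.count]

theorem psiStar_ket (m : ℤ) (s : Maya) : psiStar K m (ket K s) =
    if m ∉ s.black then (-1 : K) ^ s.count m • ket K (s.putBlack m) else 0 := by
  simp [psiStar, ket, Maya.count]

end

variable {K}

theorem psi_ket_of_mem {m : ℤ} {s : Maya} (h : m ∈ s.black) :
    psi K m (ket K s) = (-1 : K) ^ s.count m • ket K (s.putWhite m) := by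
  rw [psi_ket, if_pos h]

theorem psi_ket_of_notMem {m : ℤ} {s : Maya} (h : m ∉ s.black) : psi K m (ket K s) = 0 := by
  rw [psi_ket, if_neg h]

theorem psiStar_ket_of_notMem {m : ℤ} {s : Maya} (h : m ∉ s.black) :
    psiStar K m (ket K s) = (-1 : K) ^ s.count m • ket K (s.putBlack m) := by
  rw [psiStar_ket, if_pos h]

theorem psiStar_ket_of_mem {m : ℤ} {s : Maya} (h : m ∈ s.black) : psiStar K m (ket K s) = 0 := by
  rw [psiStar_ket, if_neg (not_not.mpr h)]

theorem psiStar_psiStar_ket_of_lt {a b : ℤ} (hab : a < b) (s : Maya) :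
    psiStar K a (psiStar K b (ket K s)) = -psiStar K b (psiStar K a (ket K s)) := by
  by_cases ha : a ∈ s.black
  · rw [psiStar_ket_of_mem ha, map_zero, neg_zero]
    by_cases hb : b ∈ s.black
    · rw [psiStar_ket_of_mem hb, map_zero]
    · rw [psiStar_ket_of_notMem hb, map_smul,
        psiStar_ket_of_mem ((Maya.mem_putBlack_of_ne hab.ne).mpr ha), smul_zero]
  by_cases hb : b ∈ s.black
  · rw [psiStar_ket_of_mem hb, map_zero, psiStar_ket_of_notMem ha, map_smul,
        psiStar_ket_of_mem ((Maya.mem_putBlack_of_ne hab.ne').mpr hb), smul_zero, neg_zero]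
  rw [psiStar_ket_of_notMem ha, psiStar_ket_of_notMem hb, map_smul, map_smul,
    psiStar_ket_of_notMem (fun h => ha ((Maya.mem_putBlack_of_ne hab.ne).mp h)),
    psiStar_ket_of_notMem (fun h => hb ((Maya.mem_putBlack_of_ne hab.ne').mp h)),
    Maya.count_putBlack_of_le hab.le, Maya.count_putBlack_of_lt ha hab, Maya.putBlack_comm,
    smul_smul, smul_smul, ← neg_smul]
  congr 1
  ring

theorem psiStar_psiStar (a b : ℤ) (v : InitialFock K) :
    psiStar K a (psiStar K b v) = -psiStar K b (psiStar K a v) := by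
  suffices h : psiStar K a ∘ₗ psiStar K b = -(psiStar K b ∘ₗ psiStar K a) from
    LinearMap.congr_fun h v
  refine linearMap_ext_ket K fun s => ?_
  change psiStar K a (psiStar K b (ket K s)) = -psiStar K b (psiStar K a (ket K s))
  rcases lt_trichotomy a b with h | rfl | h
  · exact psiStar_psiStar_ket_of_lt h s
  · by_cases ha : a ∈ s.black
    · rw [psiStar_ket_of_mem ha, map_zero, neg_zero]
    · rw [psiStar_ket_of_notMem ha, map_smul, psiStar_ket_of_mem (s.mem_putBlack a), smul_zero,
        neg_zero]
  · rw [psiStar_psiStar_ket_of_lt h s, neg_neg]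

theorem psi_psiStar_of_ne {a b : ℤ} (hab : a ≠ b) (v : InitialFock K) :
    psi K a (psiStar K b v) = -psiStar K b (psi K a v) := by
  suffices h : psi K a ∘ₗ psiStar K b = -(psiStar K b ∘ₗ psi K a) from
    LinearMap.congr_fun h v
  refine linearMap_ext_ket K fun s => ?_
  change psi K a (psiStar K b (ket K s)) = -psiStar K b (psi K a (ket K s))
  by_cases ha : a ∈ s.black
  · by_cases hb : b ∈ s.black
    · rw [psiStar_ket_of_mem hb, map_zero, psi_ket_of_mem ha, map_smul,
        psiStar_ket_of_mem ((Maya.mem_putWhite_of_ne hab.symm).mpr hb), smul_zero, neg_zero]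
    · rw [psiStar_ket_of_notMem hb, psi_ket_of_mem ha, map_smul, map_smul,
        psi_ket_of_mem ((Maya.mem_putBlack_of_ne hab).mpr ha),
        psiStar_ket_of_notMem (fun h => hb ((Maya.mem_putWhite_of_ne hab.symm).mp h)),
        Maya.putWhite_putBlack_comm hab, smul_smul, smul_smul, ← neg_smul]
      congr 1
      rcases lt_or_gt_of_ne hab with h | h
      · rw [Maya.count_putBlack_of_le h.le, Maya.count_putWhite_of_lt ha h]
        ring
      · rw [Maya.count_putBlack_of_lt hb h, Maya.count_putWhite_of_le ha h.le]
        ring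
  · rw [psi_ket_of_notMem ha, map_zero, neg_zero]
    by_cases hb : b ∈ s.black
    · rw [psiStar_ket_of_mem hb, map_zero]
    · rw [psiStar_ket_of_notMem hb, map_smul,
        psi_ket_of_notMem (fun h => ha ((Maya.mem_putBlack_of_ne hab).mp h)), smul_zero]

theorem psi_psiStar_self (a : ℤ) (v : InitialFock K) :
    psi K a (psiStar K a v) = v - psiStar K a (psi K a v) := by
  suffices h : psi K a ∘ₗ psiStar K a = LinearMap.id - psiStar K a ∘ₗ psi K a from
    LinearMap.congr_fun h v
  refine linearMap_ext_ket K fun s => ?_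
  change psi K a (psiStar K a (ket K s)) = ket K s - psiStar K a (psi K a (ket K s))
  have hsq : ∀ n : ℕ, (-1 : K) ^ n * (-1 : K) ^ n = 1 := fun n => by
    rw [← mul_pow, neg_one_mul, neg_neg, one_pow]
  by_cases ha : a ∈ s.black
  · rw [psiStar_ket_of_mem ha, map_zero, psi_ket_of_mem ha, map_smul,
      psiStar_ket_of_notMem (s.notMem_putWhite a), smul_smul, Maya.count_putWhite_of_le ha le_rfl,
      hsq, one_smul, Maya.putBlack_putWhite ha, sub_self]
  · rw [psi_ket_of_notMem ha, map_zero, sub_zero, psiStar_ket_of_notMem ha, map_smul,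
      psi_ket_of_mem (s.mem_putBlack a), smul_smul, Maya.count_putBlack_of_le le_rfl,
      hsq, one_smul, Maya.putWhite_putBlack ha]

/-- A nonzero result requires a black stone at `i` and a white one at `j`; the sign is irrelevant
for the support arguments that use this. -/
theorem psi_psiStar_ket_mem_span {i j : ℤ} (hij : i ≠ j) (s : Maya) :
    psi K i (psiStar K j (ket K s)) = 0 ∨ i ∈ s.black ∧ j ∉ s.black ∧
      ∃ c : K, psi K i (psiStar K j (ket K s)) = c • ket K ((s.putBlack j).putWhite i) := by
  by_cases hj : j ∈ s.black
  · left
    rw [psiStar_ket_of_mem hj, map_zero]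
  by_cases hi : i ∈ s.black
  · right
    rw [psiStar_ket_of_notMem hj, map_smul, psi_ket_of_mem ((Maya.mem_putBlack_of_ne hij).mpr hi),
      smul_smul]
    exact ⟨hi, hj, _, rfl⟩
  · left
    rw [psiStar_ket_of_notMem hj, map_smul,
      psi_ket_of_notMem (fun h => hi ((Maya.mem_putBlack_of_ne hij).mp h)), smul_zero]

theorem fockPairing_finalVacuum (w : InitialFock K) :
    fockPairing K (bra K Maya.finalVacuum) w = w Maya.initialVacuum := by
  classical
  -- The final vacuum has white sites `i ≤ 0`, whose negatives are the black sites `i ≥ 0` of the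
  -- initial vacuum.
  have h : ∀ s : Maya, (∀ i : ℤ, i ∉ Maya.finalVacuum.black ↔ -i ∈ s.black) ↔
      s = Maya.initialVacuum := by
    intro s
    constructor
    · intro h
      apply Maya.ext_black
      ext i
      have := h (-i)
      rw [neg_neg] at this
      rw [← this]
      simp [Maya.finalVacuum, Maya.initialVacuum]
    · rintro rfl i
      simp [Maya.finalVacuum, Maya.initialVacuum]
  rw [fockPairing, bra, Finsupp.sum_single_index]
  · rw [Finsupp.sum, Finset.sum_congr rfl fun s _ => if_congr (h s) (one_mul _) rfl,
      Finset.sum_ite_eq']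
    split_ifs with h0
    · rfl
    · exact (Finsupp.notMem_support_iff.mp h0).symm
  · simp

/-- Normal ordering therefore plays no role in `H_m` for `m ≠ 0`. -/
theorem vacuumExpectation_of_ne {i j : ℤ} (hij : i ≠ j) : vacuumExpectation K i j = 0 := by
  classical
  rw [vacuumExpectation, fockPairing_finalVacuum]
  rcases psi_psiStar_ket_mem_span (K := K) hij Maya.initialVacuum with h | ⟨_, hj, c, h⟩
  · rw [h, Finsupp.zero_apply]
  · rw [h, ket, Finsupp.smul_apply, Finsupp.single_apply, if_neg, smul_zero]
    intro hc
    rw [← hc, Maya.mem_putWhite_of_ne hij.symm] at hj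
    exact hj (Maya.mem_putBlack _ j)

theorem heisenberg_ket {m : ℤ} (hm : m ≠ 0) (s : Maya) :
    heisenberg K m (ket K s) = ∑ᶠ j : ℤ, psi K j (psiStar K (j + m) (ket K s)) := by
  have h : ∀ j : ℤ, vacuumExpectation K j (j + m) = 0 := fun j =>
    vacuumExpectation_of_ne (by omega)
  simp only [heisenberg, h, zero_smul, sub_zero, ket, Finsupp.linearCombination_single, one_smul]

theorem finite_support_psi_psiStar {m : ℤ} (hm : 0 < m) (s : Maya) :
    (Function.support fun j : ℤ => psi K j (psiStar K (j + m) (ket K s))).Finite := by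
  obtain ⟨N, h1, h2⟩ := s.finite_energy
  refine (Set.finite_Ioo (-N) N).subset fun j hj => ?_
  rcases psi_psiStar_ket_mem_span (K := K) (show j ≠ j + m by omega) s with h | ⟨hi, hk, _⟩
  · exact absurd h hj
  · constructor
    · by_contra hc
      exact h2 j (not_lt.mp hc) hi
    · by_contra hc
      exact hk (h1 _ (by omega))

theorem psiStar_ket_eq_smul (k : ℤ) (s : Maya) :
    ∃ (c : K) (t : Maya), psiStar K k (ket K s) = c • ket K t := by
  by_cases h : k ∈ s.black
  · exact ⟨0, s, by rw [psiStar_ket_of_mem h, zero_smul]⟩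
  · exact ⟨_, _, psiStar_ket_of_notMem h⟩

/-- Moving `ψ*_k` to the left through `ψ_j ψ*_{j+m}` changes sign twice, except that the term `j =
k` leaves the contraction `-ψ*_{k+m}`. -/
theorem heisenberg_psiStar {m : ℤ} (hm : 0 < m) (k : ℤ) (v : InitialFock K) :
    heisenberg K m (psiStar K k v) = psiStar K k (heisenberg K m v) - psiStar K (k + m) v := by
  suffices h : heisenberg K m ∘ₗ psiStar K k =
      psiStar K k ∘ₗ heisenberg K m - psiStar K (k + m) from LinearMap.congr_fun h v
  refine linearMap_ext_ket K fun s => ?_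
  change heisenberg K m (psiStar K k (ket K s)) =
    psiStar K k (heisenberg K m (ket K s)) - psiStar K (k + m) (ket K s)
  have h1 : heisenberg K m (psiStar K k (ket K s)) =
      ∑ᶠ j : ℤ, psi K j (psiStar K (j + m) (psiStar K k (ket K s))) := by
    obtain ⟨c, t, h⟩ := psiStar_ket_eq_smul (K := K) k s
    simp only [h, map_smul, heisenberg_ket hm.ne', smul_finsum]
  have h2 : ∀ j : ℤ, psi K j (psiStar K (j + m) (psiStar K k (ket K s))) =
      psiStar K k (psi K j (psiStar K (j + m) (ket K s))) -
        (if j = k then psiStar K (k + m) (ket K s) else 0) := fun j => by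
    rw [psiStar_psiStar, map_neg]
    split_ifs with h
    · subst h
      rw [psi_psiStar_self]
      abel
    · rw [psi_psiStar_of_ne h, neg_neg, sub_zero]
  have hfin := finite_support_psi_psiStar (K := K) hm s
  have hsub : (Function.support fun j : ℤ =>
      psiStar K k (psi K j (psiStar K (j + m) (ket K s)))) ⊆
      Function.support fun j : ℤ => psi K j (psiStar K (j + m) (ket K s)) :=
    Function.support_comp_subset (g := psiStar K k) (map_zero _) _
  have hsub' : (Function.support fun j : ℤ =>
      if j = k then psiStar K (k + m) (ket K s) else 0) ⊆ {k} := fun j hj => by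
    by_contra hc
    exact hj (if_neg hc)
  rw [h1, finsum_congr h2, finsum_sub_distrib (hfin.subset hsub) ((Set.finite_singleton k).subset hsub'),
    finsum_eq_single _ k (fun j hj => if_neg hj), if_pos rfl, heisenberg_ket hm.ne',
    map_finsum (psiStar K k) hfin]

end Heisenberg

/-! ### Exponentials of derivations -/

section TruncatedExp

open Polynomial

variable {K : Type} [Field K]

/-- The truncation of `-log (1 - w X)` at degree `D`. -/
def truncLog (w : K) (D : ℕ) : K[X] :=
  ∑ i ∈ Finset.range D, monomial (i + 1) (w ^ (i + 1) / ((i : K) + 1))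

theorem X_dvd_truncLog (w : K) (D : ℕ) : X ∣ truncLog w D :=
  Finset.dvd_sum fun i _ => ⟨monomial i (w ^ (i + 1) / ((i : K) + 1)), by
    rw [X_mul_monomial]⟩

theorem coeff_truncLog_pow {w : K} {D i k : ℕ} (h : k < i) : (truncLog w D ^ i).coeff k = 0 :=
  X_pow_dvd_iff.mp (pow_dvd_pow_of_dvd (X_dvd_truncLog w D) i) k h

/-- The derivative is `w` times a truncated geometric series, which telescopes against `1 - wX`. -/
theorem derivative_truncLog [CharZero K] (w : K) (D : ℕ) :
    (1 - C w * X) * derivative (truncLog w D) = C w - C (w ^ (D + 1)) * X ^ D := by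
  have h : derivative (truncLog w D) = C w * ∑ i ∈ Finset.range D, (C w * X) ^ i := by
    rw [truncLog, derivative_sum, Finset.mul_sum]
    refine Finset.sum_congr rfl fun i _ => ?_
    rw [derivative_monomial, mul_pow, ← C_pow, ← mul_assoc, ← C_mul, C_mul_X_pow_eq_monomial,
      Nat.add_sub_cancel]
    congr 1
    have : (i : K) + 1 ≠ 0 := by exact_mod_cast Nat.succ_ne_zero i
    push_cast
    field_simp
    ring
  rw [h, mul_left_comm, mul_neg_geom_sum, mul_pow, ← C_pow, mul_sub, mul_one, ← mul_assoc, ← C_mul,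
    pow_succ']

/-- `exp (-log (1 - w X)) = 1 / (1 - w X)`, up to degree `D`. -/
theorem coeff_exp_truncLog [CharZero K] (w : K) (D : ℕ) {k : ℕ} (hk : k ≤ D) :
    (∑ i ∈ Finset.range (D + 1), C ((i.factorial : K)⁻¹) * truncLog w D ^ i).coeff k = w ^ k := by
  set B := truncLog w D with hB
  set G := ∑ i ∈ Finset.range (D + 1), C ((i.factorial : K)⁻¹) * B ^ i with hG
  -- Differentiation shifts the exponential sum by one index, so exactly its last term is lost.
  have hder : derivative G = derivative B * (G - C ((D.factorial : K)⁻¹) * B ^ D) := by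
    rw [hG, Finset.sum_range_succ, add_sub_cancel_right, ← Finset.sum_range_succ,
      Finset.sum_range_succ', derivative_add, derivative_sum, Finset.mul_sum]
    simp only [pow_zero, mul_one, derivative_C, add_zero]
    refine Finset.sum_congr rfl fun i _ => ?_
    rw [derivative_C_mul, derivative_pow_succ, Nat.factorial_succ]
    have h1 : (i : K) + 1 ≠ 0 := by exact_mod_cast Nat.succ_ne_zero i
    have h2 : (i.factorial : K) ≠ 0 := by exact_mod_cast i.factorial_ne_zero
    have h3 : (((i + 1) * i.factorial : ℕ) : K)⁻¹ * ((i : K) + 1) = (i.factorial : K)⁻¹ := by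
      push_cast
      field_simp
    rw [← h3, C_mul]
    ring
  -- Modulo `X ^ D` this is the equation `(1 - wX) G' = w G`, since `X` divides `B`. Comparing
  -- coefficients of degree `k < D` gives the recursion for `1 / (1 - wX)`.
  have hode : (1 - C w * X) * derivative G = C w * G - X ^ D * (C (w ^ (D + 1)) *
      (G - C ((D.factorial : K)⁻¹) * B ^ D)) - C w * C ((D.factorial : K)⁻¹) * B ^ D := by
    rw [hder, ← mul_assoc, hB, derivative_truncLog]
    ring
  induction k with
  | zero =>
    rw [hG, Finset.sum_range_succ', coeff_add, finsetSum_coeff, Finset.sum_eq_zero]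
    · simp
    · intro i _
      rw [coeff_C_mul, coeff_truncLog_pow (Nat.succ_pos i), mul_zero]
  | succ k ih =>
    have ih := ih (by omega)
    have h := congrArg (fun p => p.coeff k) hode
    rw [coeff_sub, coeff_sub, coeff_X_pow_mul', if_neg (by omega), ← C_mul, coeff_C_mul, coeff_C_mul,
      coeff_truncLog_pow (by omega), ih, sub_mul, one_mul, coeff_sub, coeff_derivative,
      mul_assoc, coeff_C_mul] at h
    have h1 : (X * derivative G).coeff k = w ^ k * k := by
      cases k with
      | zero => simp
      | succ j => rw [coeff_X_mul, coeff_derivative, ih]; push_cast; ring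
    rw [h1] at h
    have h2 : (k : K) + 1 ≠ 0 := by exact_mod_cast Nat.succ_ne_zero k
    apply mul_right_cancel₀ h2
    rw [pow_succ]
    linear_combination h

end TruncatedExp

section ExpLeibniz

open Polynomial Finset

variable {K : Type*} [Field K] {M : Type*} [AddCommGroup M] [Module K M]

/-- The exponential series of `A`, truncated after `R` terms. -/
def expSum (A : M →ₗ[K] M) (R : ℕ) (v : M) : M :=
  ∑ n ∈ range R, ((n.factorial : K)⁻¹) • (A ^ n) v

theorem pow_apply_eq_zero {A : M →ₗ[K] M} {L n : ℕ} {v : M} (h : (A ^ L) v = 0) (hn : L ≤ n) :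
    (A ^ n) v = 0 := by
  obtain ⟨k, rfl⟩ := Nat.exists_eq_add_of_le' hn
  rw [pow_add, Module.End.mul_apply, h, map_zero]

/-- The hypothesis says that `A` acts on `Φ p v` as a sum of two commuting operations, `A` on `v`
and multiplication by `B` on `p`; this is their binomial formula. -/
theorem pow_leibniz {A : M →ₗ[K] M} {Φ : K[X] →ₗ[K] M →ₗ[K] M} {B : K[X]}
    (hA : ∀ p v, A (Φ p v) = Φ p (A v) + Φ (B * p) v) (n : ℕ) (p : K[X]) (v : M) :
    (A ^ n) (Φ p v) = ∑ x ∈ antidiagonal n, n.choose x.1 • Φ (B ^ x.1 * p) ((A ^ x.2) v) := by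
  induction n with
  | zero => simp
  | succ n ih =>
    rw [sum_antidiagonal_choose_succ_nsmul (fun i l => Φ (B ^ i * p) ((A ^ l) v)), pow_succ',
      Module.End.mul_apply, ih, map_sum, ← sum_add_distrib]
    refine sum_congr rfl fun x hx => ?_
    rw [map_nsmul, hA, nsmul_add, pow_succ' A, Module.End.mul_apply, ← mul_assoc, ← pow_succ',
      Nat.choose_symm_of_eq_add (mem_antidiagonal.mp hx).symm]

/-- The exponential of a derivation, applied to a product. -/
theorem expSum_leibniz [CharZero K] {A : M →ₗ[K] M} {Φ : K[X] →ₗ[K] M →ₗ[K] M} {B : K[X]}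
    (hA : ∀ p v, A (Φ p v) = Φ p (A v) + Φ (B * p) v) {v : M} {L D : ℕ} (hL : (A ^ L) v = 0)
    (hD : ∀ i, D ≤ i → ∀ l, Φ (B ^ i) ((A ^ l) v) = 0) :
    (A ^ (D + L)) (Φ 1 v) = 0 ∧ expSum A (D + L) (Φ 1 v) =
      Φ (∑ i ∈ range D, C ((i.factorial : K)⁻¹) * B ^ i) (expSum A L v) := by
  have hzero : ∀ i l, D ≤ i ∨ L ≤ l → Φ (B ^ i) ((A ^ l) v) = 0 := by
    rintro i l (h | h)
    · exact hD i h l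
    · rw [pow_apply_eq_zero hL h, map_zero]
  have hpow : ∀ n, (A ^ n) (Φ 1 v) =
      ∑ x ∈ antidiagonal n, n.choose x.1 • Φ (B ^ x.1) ((A ^ x.2) v) := fun n => by
    simpa using pow_leibniz hA n 1 v
  constructor
  · rw [hpow]
    refine sum_eq_zero fun x hx => ?_
    have := mem_antidiagonal.mp hx
    rw [hzero _ _ (by omega), smul_zero]
  -- The binomial coefficient cancels against `n!`, and pairs outside the rectangle `range D × range
  -- L` contribute zero, so the double sum becomes a product of two truncated exponentials.
  · have hterm : ∀ n, ((n.factorial : K)⁻¹) • (A ^ n) (Φ 1 v) =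
        ∑ x ∈ range D ×ˢ range L with x.1 + x.2 = n,
          ((x.1.factorial : K)⁻¹ * (x.2.factorial : K)⁻¹) • Φ (B ^ x.1) ((A ^ x.2) v) := fun n => by
      rw [hpow, smul_sum]
      symm
      refine (sum_subset (fun x hx => ?_) fun x _ hx => ?_).trans (sum_congr rfl fun x hx => ?_)
      · exact mem_antidiagonal.mpr (mem_filter.mp hx).2
      · have h1 : D ≤ x.1 ∨ L ≤ x.2 := by
          by_contra hc
          simp only [mem_filter, mem_product, mem_range] at hx
          have := mem_antidiagonal.mp ‹_›
          omega
        rw [hzero _ _ h1, smul_zero]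
      · rw [← Nat.cast_smul_eq_nsmul K, smul_smul]
        congr 1
        have h1 := mem_antidiagonal.mp hx
        have h2 := Nat.add_choose_mul_factorial_mul_factorial x.1 x.2
        rw [h1, ← Nat.choose_symm_of_eq_add h1.symm] at h2
        have h3 : (n.factorial : K) ≠ 0 := by exact_mod_cast n.factorial_ne_zero
        have h4 : (x.1.factorial : K) ≠ 0 := by exact_mod_cast x.1.factorial_ne_zero
        have h5 : (x.2.factorial : K) ≠ 0 := by exact_mod_cast x.2.factorial_ne_zero
        field_simp
        rw [← h2]
        push_cast
        ring
    rw [expSum, sum_congr rfl fun n _ => hterm n, sum_fiberwise_of_maps_to fun x hx => ?_]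
    · rw [sum_product, map_sum, LinearMap.sum_apply]
      refine sum_congr rfl fun i _ => ?_
      rw [← smul_eq_C_mul, map_smul, LinearMap.smul_apply, expSum, map_sum, smul_sum]
      refine sum_congr rfl fun l _ => ?_
      rw [map_smul, smul_smul]
    · simp only [mem_product, mem_range] at hx ⊢
      omega

end ExpLeibniz

/-! ### The vertex operator `Γ_+` on states -/

namespace Maya

/-- The Maya diagram of charge `c` and partition `p`: the black sites are `k + c - p_k`. -/
def ofPart (c : ℤ) (p : PartSeq) : Maya where
  black := {i | ∃ k : ℕ, i = k + c - p.part k}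
  finite_energy := by
    obtain ⟨n, hn⟩ := p.eventually_zero
    refine ⟨|c| + n + p.part 0 + 1, fun i hi => ⟨(i - c).toNat, ?_⟩, ?_⟩
    · have := le_abs_self c
      rw [hn _ (by omega)]
      omega
    · rintro i hi ⟨k, hk⟩
      have := neg_abs_le c
      have := p.anti (Nat.zero_le k)
      omega

theorem mem_ofPart {c : ℤ} {p : PartSeq} {i : ℤ} :
    i ∈ (ofPart c p).black ↔ ∃ k : ℕ, i = k + c - p.part k := Iff.rfl

theorem le_of_mem_ofPart {c : ℤ} {p : PartSeq} {i : ℤ} (h : i ∈ (ofPart c p).black) :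
    c - p.part 0 ≤ i := by
  obtain ⟨k, rfl⟩ := mem_ofPart.mp h
  have := p.anti (Nat.zero_le k)
  omega

theorem mem_ofPart_of_le {c : ℤ} {p : PartSeq} {n : ℕ} (hn : ∀ k, n ≤ k → p.part k = 0) {i : ℤ}
    (h : c + n ≤ i) : i ∈ (ofPart c p).black :=
  mem_ofPart.mpr ⟨(i - c).toNat, by rw [hn _ (by omega)]; omega⟩

theorem notMem_ofPart_succ {c : ℤ} {p : PartSeq} {a : ℕ} (h : p.part 0 ≤ a) :
    c - a ∉ (ofPart (c + 1) p).black := fun hc => by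
  have := le_of_mem_ofPart hc
  omega

theorem ofPart_cons {c : ℤ} {p : PartSeq} {a : ℕ} (h : p.part 0 ≤ a) :
    ofPart c (p.cons a) = (ofPart (c + 1) p).putBlack (c - a) := by
  apply ext_black
  ext i
  simp only [putBlack, Set.mem_insert_iff, mem_ofPart]
  constructor
  · rintro ⟨k, hk⟩
    cases k with
    | zero =>
      rw [PartSeq.cons_part_zero h] at hk
      left
      simpa using hk
    | succ k =>
      rw [PartSeq.cons_part_succ] at hk
      exact Or.inr ⟨k, by rw [hk]; push_cast; ring⟩
  · rintro (rfl | ⟨k, hk⟩)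
    · exact ⟨0, by rw [PartSeq.cons_part_zero h]; simp⟩
    · exact ⟨k + 1, by rw [hk, PartSeq.cons_part_succ]; push_cast; ring⟩

theorem count_ofPart_succ {c : ℤ} {p : PartSeq} {a : ℕ} (h : p.part 0 ≤ a) :
    (ofPart (c + 1) p).count (c - a) = 0 := by
  rw [count, Set.ncard_eq_zero (finite_lt _ _), Set.eq_empty_iff_forall_notMem]
  rintro j ⟨hj, hlt⟩
  have := le_of_mem_ofPart hj
  omega

/-- Remove the leftmost black stone and induct on the number of black stones to the left of `N`,
beyond which all sites are black. -/
theorem exists_ofPart (s : Maya) : ∃ c p, s = ofPart c p := by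
  obtain ⟨N, hN, hN'⟩ := s.finite_energy
  induction h : s.count N using Nat.strong_induction_on generalizing s with
  | _ n ih =>
    by_cases hs : ∃ j, j ∈ s.black ∧ j < N
    · obtain ⟨j, ⟨hj, hjN⟩, hmin⟩ := (s.finite_lt N).exists_minimal hs
      have hmin' : ∀ i ∈ s.black, j ≤ i := fun i hi => by
        by_contra hc
        exact hc (hmin ⟨hi, by omega⟩ (by omega))
      obtain ⟨c, p, hp⟩ := ih ((s.putWhite j).count N)
        (by rw [← h, count_putWhite_of_lt hj hjN]; omega) (s.putWhite j)
        (fun i hi => (mem_putWhite_of_ne (by omega)).mpr (hN i hi)) (fun i hi hc => hN' i hi hc.1) rfl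
      have hjlt : j < c - p.part 0 := by
        have h1 : c - p.part 0 ∈ (s.putWhite j).black := hp ▸ mem_ofPart.mpr ⟨0, by simp⟩
        exact lt_of_le_of_ne (hmin' _ h1.1) fun hc => h1.2 hc.symm
      -- Adding a stone lowers the charge to `c - 1`, and the new part `a` is determined by `j = (c
      -- - 1) - a`; minimality of `j` gives `p_0 ≤ a`.
      refine ⟨c - 1, p.cons (c - 1 - j).toNat, ?_⟩
      rw [ofPart_cons (by omega), sub_add_cancel, ← hp,
        show c - 1 - ((c - 1 - j).toNat : ℤ) = j by omega, putBlack_putWhite hj]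
    · push Not at hs
      refine ⟨N, 0, ext_black (Set.ext fun i => ⟨fun hi => ?_, fun hi => ?_⟩)⟩
      · exact mem_ofPart_of_le (n := 0) (fun _ _ => rfl) (by simpa using hs i hi)
      · exact hN i (by simpa using le_of_mem_ofPart hi)

theorem ofPart_zero_zero : ofPart 0 0 = initialVacuum := by
  apply ext_black
  ext i
  constructor
  · intro hi
    simpa [initialVacuum] using le_of_mem_ofPart hi
  · intro hi
    exact mem_ofPart_of_le (n := 0) (fun _ _ => rfl) (by simpa [initialVacuum] using hi)

theorem strictMono_ofPart (c : ℤ) (p : PartSeq) : StrictMono fun k : ℕ => (k : ℤ) + c - p.part k :=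
  strictMono_nat_of_lt_succ fun k => by
    have := p.anti (show k ≤ k + 1 by omega)
    push_cast
    omega

/-- Two strictly increasing enumerations of the same set agree, and far to the right, where the
parts vanish, they determine the charge. -/
theorem ofPart_injective {c d : ℤ} {p r : PartSeq} (h : ofPart c p = ofPart d r) :
    c = d ∧ p = r := by
  have h1 : Set.range (fun k : ℕ => (k : ℤ) + c - p.part k) =
      Set.range fun k : ℕ => (k : ℤ) + d - r.part k := by
    ext i
    have := Set.ext_iff.mp (congrArg Maya.black h) i
    rw [mem_ofPart, mem_ofPart] at this
    simpa [eq_comm] using this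
  have h2 := fun k => congrFun (((strictMono_ofPart c p).range_inj (strictMono_ofPart d r)).mp h1) k
  obtain ⟨n, hn⟩ := p.eventually_zero
  obtain ⟨m, hm⟩ := r.eventually_zero
  have h3 := h2 (max n m)
  rw [hn _ (le_max_left _ _), hm _ (le_max_right _ _)] at h3
  have hcd : c = d := by omega
  refine ⟨hcd, PartSeq.ext (funext fun k => ?_)⟩
  have := h2 k
  omega

end Maya

/-! ### Action of `Γ_+` on the states `|c, p⟩` -/

section VertexOperator

open Polynomial

variable {K : Type} [Field K]

theorem psiStar_ket_ofPart {c : ℤ} {p : PartSeq} {a : ℕ} (h : p.part 0 ≤ a) :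
    psiStar K (c - a) (ket K (Maya.ofPart (c + 1) p)) = ket K (Maya.ofPart c (p.cons a)) := by
  rw [psiStar_ket_of_notMem (Maya.notMem_ofPart_succ h), Maya.count_ofPart_succ h, pow_zero,
    one_smul, Maya.ofPart_cons h]

/-- The states all of whose sites `i ≥ N` are black and all of whose sites `i < -N` are white. -/
def boxed (K : Type) [Field K] (N : ℤ) : Submodule K (InitialFock K) :=
  Submodule.span K (ket K '' {s | (∀ i, N ≤ i → i ∈ s.black) ∧ ∀ i, i < -N → i ∉ s.black})

theorem ket_mem_boxed {N : ℤ} {s : Maya} (h1 : ∀ i, N ≤ i → i ∈ s.black)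
    (h2 : ∀ i, i < -N → i ∉ s.black) : ket K s ∈ boxed K N :=
  Submodule.subset_span ⟨s, ⟨h1, h2⟩, rfl⟩

theorem psiStar_eq_zero_of_boxed {N k : ℤ} (hk : N ≤ k) {v : InitialFock K} (hv : v ∈ boxed K N) :
    psiStar K k v = 0 := by
  suffices h : boxed K N ≤ LinearMap.ker (psiStar K k) from h hv
  refine Submodule.span_le.mpr ?_
  rintro _ ⟨s, ⟨h1, _⟩, rfl⟩
  exact psiStar_ket_of_mem (h1 k hk)

theorem psi_psiStar_mem_boxed {N j m : ℤ} (hm : 0 < m) {s : Maya} (h1 : ∀ i, N ≤ i → i ∈ s.black)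
    (h2 : ∀ i, i < -N → i ∉ s.black) : psi K j (psiStar K (j + m) (ket K s)) ∈ boxed K N := by
  rcases psi_psiStar_ket_mem_span (K := K) (show j ≠ j + m by omega) s with h | ⟨hj, hk, c, h⟩
  · rw [h]
    exact Submodule.zero_mem _
  rw [h]
  have h3 : -N ≤ j := by
    by_contra hc
    exact h2 j (by omega) hj
  have h4 : j + m < N := by
    by_contra hc
    exact hk (h1 _ (by omega))
  refine Submodule.smul_mem _ _ (ket_mem_boxed (fun i hi => ?_) fun i hi hc => ?_)
  · rw [Maya.mem_putWhite_of_ne (by omega), Maya.mem_putBlack_of_ne (by omega)]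
    exact h1 i hi
  · rw [Maya.mem_putWhite_of_ne (by omega), Maya.mem_putBlack_of_ne (by omega)] at hc
    exact h2 i hi hc

theorem heisenberg_mem_boxed {N m : ℤ} (hm : 0 < m) {v : InitialFock K} (hv : v ∈ boxed K N) :
    heisenberg K m v ∈ boxed K N := by
  suffices h : boxed K N ≤ (boxed K N).comap (heisenberg K m) from h hv
  refine Submodule.span_le.mpr ?_
  rintro _ ⟨s, ⟨h1, h2⟩, rfl⟩
  rw [SetLike.mem_coe, Submodule.mem_comap, heisenberg_ket hm.ne']
  exact finsum_induction (· ∈ boxed K N) (Submodule.zero_mem _)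
    (fun _ _ => Submodule.add_mem _) fun j => psi_psiStar_mem_boxed hm h1 h2

/-- A movable stone sits at a site `≥ -N` and must land on a white site `< N`, so it cannot jump by
`2N` or more. On boxed states `H_+(z)` is thus a finite sum. -/
theorem heisenberg_eq_zero_of_boxed {N m : ℤ} (hm : 0 < m) (hN : 2 * N ≤ m) {v : InitialFock K}
    (hv : v ∈ boxed K N) : heisenberg K m v = 0 := by
  suffices h : boxed K N ≤ LinearMap.ker (heisenberg K m) from h hv
  refine Submodule.span_le.mpr ?_
  rintro _ ⟨s, ⟨h1, h2⟩, rfl⟩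
  rw [SetLike.mem_coe, LinearMap.mem_ker, heisenberg_ket hm.ne']
  refine finsum_eq_zero_of_forall_eq_zero fun j => ?_
  rcases psi_psiStar_ket_mem_span (K := K) (show j ≠ j + m by omega) s with h | ⟨hj, hk, _⟩
  · exact h
  · have h3 : -N ≤ j := by
      by_contra hc
      exact h2 j (by omega) hj
    exact absurd (h1 _ (by omega)) hk

theorem heisenberg_ofPart_zero {m : ℤ} (hm : 0 < m) (c : ℤ) :
    heisenberg K m (ket K (Maya.ofPart c 0)) = 0 := by
  rw [heisenberg_ket hm.ne']
  refine finsum_eq_zero_of_forall_eq_zero fun j => ?_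
  rcases psi_psiStar_ket_mem_span (K := K) (show j ≠ j + m by omega) (Maya.ofPart c 0) with
    h | ⟨hj, hk, _⟩
  · exact h
  · have := Maya.le_of_mem_ofPart hj
    rw [PartSeq.zero_part] at this
    exact absurd (Maya.mem_ofPart_of_le (n := 0) (fun _ _ => rfl) (by push_cast at *; omega)) hk

/-- The sum of the first `D` terms of `H_+(z)`. -/
def truncHeisenberg (z : K) (D : ℕ) : InitialFock K →ₗ[K] InitialFock K :=
  ∑ i ∈ Finset.range D, timeVar z ((i + 1 : ℕ) : ℤ) • heisenberg K ((i + 1 : ℕ) : ℤ)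

theorem truncHeisenberg_apply (z : K) (D : ℕ) (v : InitialFock K) : truncHeisenberg z D v =
    ∑ i ∈ Finset.range D, timeVar z ((i + 1 : ℕ) : ℤ) • heisenberg K ((i + 1 : ℕ) : ℤ) v := by
  simp [truncHeisenberg, LinearMap.sum_apply]

theorem timeVar_succ (z : K) (i : ℕ) :
    timeVar z ((i + 1 : ℕ) : ℤ) = -(z⁻¹ ^ (i + 1) / ((i : K) + 1)) := by
  rw [timeVar, zpow_neg, zpow_natCast, inv_pow, neg_div]
  push_cast
  rfl

theorem truncHeisenberg_mem_boxed {z : K} {D : ℕ} {N : ℤ} {v : InitialFock K}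
    (hv : v ∈ boxed K N) : truncHeisenberg z D v ∈ boxed K N := by
  rw [truncHeisenberg_apply]
  exact Submodule.sum_mem _ fun i _ => Submodule.smul_mem _ _ (heisenberg_mem_boxed (by omega) hv)

theorem truncHeisenberg_pow_mem_boxed {z : K} {D : ℕ} {N : ℤ} {v : InitialFock K}
    (hv : v ∈ boxed K N) (n : ℕ) : (truncHeisenberg z D ^ n) v ∈ boxed K N := by
  induction n with
  | zero => exact hv
  | succ n ih =>
    rw [pow_succ', Module.End.mul_apply]
    exact truncHeisenberg_mem_boxed ih

theorem expSum_mem_boxed {z : K} {D : ℕ} {N : ℤ} {v : InitialFock K}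
    (hv : v ∈ boxed K N) (L : ℕ) : expSum (truncHeisenberg z D) L v ∈ boxed K N :=
  Submodule.sum_mem _ fun n _ => Submodule.smul_mem _ _ (truncHeisenberg_pow_mem_boxed hv n)

theorem heisenbergPlus_eq_truncHeisenberg {z : K} {D : ℕ} {N : ℤ} (hD : 2 * N ≤ D)
    {v : InitialFock K} (hv : v ∈ boxed K N) : heisenbergPlus z v = truncHeisenberg z D v := by
  suffices h : boxed K N ≤ LinearMap.eqLocus (heisenbergPlus z) (truncHeisenberg z D) from h hv
  refine Submodule.span_le.mpr ?_
  rintro _ ⟨s, hs, rfl⟩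
  have hs' : ket K s ∈ boxed K N := ket_mem_boxed hs.1 hs.2
  rw [SetLike.mem_coe, LinearMap.mem_eqLocus, truncHeisenberg_apply]
  have h1 : heisenbergPlus z (ket K s) =
      ∑ᶠ m : ℕ+, timeVar z ((m : ℕ) : ℤ) • heisenberg K ((m : ℕ) : ℤ) (ket K s) := by
    simp [heisenbergPlus, ket]
  rw [h1, finsum_eq_finsetSum_of_support_subset (s := (Finset.range D).map
    ⟨Nat.succPNat, Nat.succPNat_injective⟩), Finset.sum_map]
  · rfl
  · intro m hm
    have hlt : (m : ℕ) - 1 < D := by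
      by_contra hc
      refine hm ?_
      dsimp only
      rw [heisenberg_eq_zero_of_boxed (by exact_mod_cast m.pos) (by omega) hs', smul_zero]
    simp only [Finset.coe_map, Function.Embedding.coeFn_mk, Set.mem_image, Finset.coe_range,
      Set.mem_Iio]
    refine ⟨_, hlt, PNat.eq ?_⟩
    have := m.pos
    simp only [Nat.succPNat_coe]
    omega

theorem heisenbergPlus_pow_eq {z : K} {D : ℕ} {N : ℤ} (hD : 2 * N ≤ D)
    {v : InitialFock K} (hv : v ∈ boxed K N) (n : ℕ) :
    (heisenbergPlus z ^ n) v = (truncHeisenberg z D ^ n) v := by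
  induction n with
  | zero => rfl
  | succ n ih =>
    rw [pow_succ', pow_succ', Module.End.mul_apply, Module.End.mul_apply, ih,
      heisenbergPlus_eq_truncHeisenberg hD (truncHeisenberg_pow_mem_boxed hv n)]

theorem gammaPlus_ket_eq_expSum {z : K} {D L : ℕ} {N : ℤ} (hD : 2 * N ≤ D) {s : Maya}
    (hs : ket K s ∈ boxed K N) (hL : (truncHeisenberg z D ^ L) (ket K s) = 0) :
    gammaPlus z (ket K s) = expSum (truncHeisenberg z D) L (ket K s) := by
  have h1 : gammaPlus z (ket K s) =
      ∑ᶠ n : ℕ, ((n.factorial : K)⁻¹) • ((heisenbergPlus z) ^ n) (ket K s) := by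
    simp [gammaPlus, ket]
  rw [h1, finsum_eq_finsetSum_of_support_subset (s := Finset.range L)]
  · exact Finset.sum_congr rfl fun n _ => by rw [heisenbergPlus_pow_eq hD hs]
  · intro n hn
    by_contra hc
    refine hn ?_
    dsimp only
    rw [heisenbergPlus_pow_eq hD hs, pow_apply_eq_zero hL (by simpa using hc), smul_zero]

/-- `∑ p_i ψ*_{j+i}` for the polynomial `∑ p_i X^i`. -/
def psiStarPoly (K : Type) [Field K] (j : ℤ) : K[X] →ₗ[K] InitialFock K →ₗ[K] InitialFock K :=
  (Polynomial.basisMonomials K).constr K fun i : ℕ => psiStar K (j + i)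

theorem psiStarPoly_monomial (j : ℤ) (i : ℕ) (c : K) (v : InitialFock K) :
    psiStarPoly K j (monomial i c) v = c • psiStar K (j + i) v := by
  have h : psiStarPoly K j (monomial i 1) = psiStar K (j + i) := by
    have := (Polynomial.basisMonomials K).constr_basis K (fun i : ℕ => psiStar K (j + i)) i
    rwa [Polynomial.coe_basisMonomials] at this
  rw [← mul_one c, ← smul_eq_mul, ← smul_monomial, map_smul, h, smul_eq_mul, mul_one,
    LinearMap.smul_apply]

theorem psiStarPoly_eq_sum {j : ℤ} {p : K[X]} {v : InitialFock K} {n : ℕ}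
    (h : ∀ i, n ≤ i → psiStar K (j + i) v = 0) :
    psiStarPoly K j p v = ∑ i ∈ Finset.range n, p.coeff i • psiStar K (j + i) v := by
  conv_lhs => rw [p.as_sum_range' (max n (p.natDegree + 1)) (by omega)]
  rw [map_sum, LinearMap.sum_apply]
  simp_rw [psiStarPoly_monomial]
  symm
  refine Finset.sum_subset (Finset.range_mono (le_max_left _ _)) fun i _ hi => ?_
  rw [h i (by simpa using hi), smul_zero]

/-- The derivation property required by `expSum_leibniz`: the minus signs of the time variables and
of `[H_m, ψ*_k]` cancel, leaving multiplication by `truncLog z⁻¹ D`. -/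
theorem truncHeisenberg_psiStarPoly (z : K) (D : ℕ) (j : ℤ) (p : K[X]) (v : InitialFock K) :
    truncHeisenberg z D (psiStarPoly K j p v) =
      psiStarPoly K j p (truncHeisenberg z D v) + psiStarPoly K j (truncLog z⁻¹ D * p) v := by
  induction p using Polynomial.induction_on' with
  | add p r hp hr =>
    rw [mul_add, map_add, map_add, LinearMap.add_apply, LinearMap.add_apply, LinearMap.add_apply,
      map_add, hp, hr]
    abel
  | monomial i c =>
    rw [psiStarPoly_monomial, psiStarPoly_monomial, map_smul, truncHeisenberg_apply,
      truncHeisenberg_apply, truncLog, Finset.sum_mul, map_sum, map_sum, LinearMap.sum_apply,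
      Finset.smul_sum, Finset.smul_sum, ← Finset.sum_add_distrib]
    refine Finset.sum_congr rfl fun k _ => ?_
    rw [heisenberg_psiStar (by omega), monomial_mul_monomial, psiStarPoly_monomial, timeVar_succ,
      map_smul, show j + i + ((k + 1 : ℕ) : ℤ) = j + ((k + 1 + i : ℕ) : ℤ) by push_cast; ring]
    module

/-- The generating operator `∑ w^i ψ*_{j+i}`, truncated. -/
def psiStarGeom (w : K) (D : ℕ) (j : ℤ) (v : InitialFock K) : InitialFock K :=
  ∑ i ∈ Finset.range (D + 1), w ^ i • psiStar K (j + i) v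

/-- The `ψ*` anticommute, so the square equals its own negative. -/
theorem psiStarGeom_psiStarGeom [CharZero K] (w : K) (D : ℕ) (j : ℤ) (v : InitialFock K) :
    psiStarGeom w D j (psiStarGeom w D j v) = 0 := by
  have h : psiStarGeom w D j (psiStarGeom w D j v) = -psiStarGeom w D j (psiStarGeom w D j v) := by
    simp only [psiStarGeom, map_sum, map_smul, Finset.smul_sum]
    conv_rhs => rw [Finset.sum_comm]
    rw [← Finset.sum_neg_distrib]
    refine Finset.sum_congr rfl fun i _ => ?_
    rw [← Finset.sum_neg_distrib]
    refine Finset.sum_congr rfl fun k _ => ?_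
    rw [psiStar_psiStar, smul_neg, smul_neg, smul_comm]
  have h2 : (2 : K) • psiStarGeom w D j (psiStarGeom w D j v) = 0 := by
    rw [two_smul]
    nth_rw 1 [h]
    exact neg_add_cancel _
  exact (smul_eq_zero.mp h2).resolve_left two_ne_zero

/-- The intertwining `Γ_+(z) ψ*_j = (∑ z^{-i} ψ*_{j+i}) Γ_+(z)` on boxed states. There `ψ*_{j+i}`
vanishes for `i > D`, so knowing the exponential up to degree `D` suffices. -/
theorem expSum_psiStar [CharZero K] {z : K} {D L : ℕ} {N j : ℤ} (hD : 2 * N ≤ D) (hj : -N ≤ j)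
    {v : InitialFock K} (hv : v ∈ boxed K N) (hL : (truncHeisenberg z D ^ L) v = 0) :
    (truncHeisenberg z D ^ (D + 1 + L)) (psiStar K j v) = 0 ∧
      expSum (truncHeisenberg z D) (D + 1 + L) (psiStar K j v) =
        psiStarGeom z⁻¹ D j (expSum (truncHeisenberg z D) L v) := by
  have hz : ∀ u ∈ boxed K N, ∀ i, D + 1 ≤ i → psiStar K (j + i) u = 0 := fun u hu i hi =>
    psiStar_eq_zero_of_boxed (by omega) hu
  have h1 : psiStarPoly K j 1 v = psiStar K j v := by
    rw [← monomial_zero_one, psiStarPoly_monomial, one_smul, Nat.cast_zero, add_zero]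
  have h2 := expSum_leibniz (truncHeisenberg_psiStarPoly z D j) hL (D := D + 1) fun i hi l => by
    rw [psiStarPoly_eq_sum (hz _ (truncHeisenberg_pow_mem_boxed hv l))]
    refine Finset.sum_eq_zero fun k hk => ?_
    rw [coeff_truncLog_pow (by simp only [Finset.mem_range] at hk; omega), zero_smul]
  rw [h1] at h2
  refine ⟨h2.1, h2.2.trans ?_⟩
  rw [psiStarPoly_eq_sum (hz _ (expSum_mem_boxed hv L)), psiStarGeom]
  refine Finset.sum_congr rfl fun k hk => ?_
  rw [coeff_exp_truncLog _ _ (by simp only [Finset.mem_range] at hk; omega)]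

/-- The part of the series beyond the site `c - b` is `w^{a-b+1}` times the same series started at
`c + 1 - b`, which kills `v`. This cuts the sum off at `x = b`. -/
theorem psiStarGeom_eq_sum_Icc {w : K} {D a b : ℕ} {N c : ℤ} (hD : 2 * N ≤ D) (hba : b ≤ a)
    (hc : -N ≤ c - a) {v : InitialFock K} (hv : v ∈ boxed K N)
    (hv' : psiStarGeom w D (c + 1 - b) v = 0) :
    psiStarGeom w D (c - a) v = ∑ x ∈ Finset.Icc b a, w ^ (a - x) • psiStar K (c - x) v := by
  have h1 : psiStarGeom w D (c - a) v =
      ∑ i ∈ Finset.range (a - b + 1 + (D + 1)), w ^ i • psiStar K (c - a + i) v := by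
    -- The added terms insert stones at sites `≥ N`, which are already black.
    refine Finset.sum_subset (Finset.range_mono (by omega)) fun i _ hi => ?_
    rw [psiStar_eq_zero_of_boxed (N := N) (by simp only [Finset.mem_range] at hi; omega) hv, smul_zero]
  have h2 : ∑ i ∈ Finset.range (D + 1), w ^ (a - b + 1 + i) •
      psiStar K (c - a + ((a - b + 1 + i : ℕ) : ℤ)) v = w ^ (a - b + 1) • psiStarGeom w D (c + 1 - b) v := by
    rw [psiStarGeom, Finset.smul_sum]
    refine Finset.sum_congr rfl fun i _ => ?_
    rw [smul_smul, pow_add, show c - a + ((a - b + 1 + i : ℕ) : ℤ) = c + 1 - b + i by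
      push_cast [Nat.cast_sub hba]; ring]
  rw [h1, Finset.sum_range_add, h2, hv', smul_zero, add_zero]
  refine Finset.sum_bij' (fun i _ => a - i) (fun x _ => a - x) ?_ ?_ ?_ ?_ ?_
  · intro i hi
    simp only [Finset.mem_range, Finset.mem_Icc] at hi ⊢
    omega
  · intro i hi
    simp only [Finset.mem_range, Finset.mem_Icc] at hi ⊢
    omega
  · intro i hi
    simp only [Finset.mem_range] at hi
    omega
  · intro i hi
    simp only [Finset.mem_Icc] at hi
    omega
  · intro i hi
    simp only [Finset.mem_range] at hi
    rw [show a - (a - i) = i by omega, show c - ((a - i : ℕ) : ℤ) = c - a + i by omega]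

theorem ket_ofPart_mem_boxed {n : ℕ} {N c : ℤ} {p : PartSeq} (hn : ∀ k, n ≤ k → p.part k = 0)
    (h1 : c + n ≤ N) (h2 : -N ≤ c - p.part 0) : ket K (Maya.ofPart c p) ∈ boxed K N :=
  ket_mem_boxed (fun i hi => Maya.mem_ofPart_of_le hn (by omega)) fun i hi hc => by
    have := Maya.le_of_mem_ofPart hc
    omega

/-- Induction on the number of parts. The third conclusion is carried along because, for `r` at
charge `c + 1`, it is exactly the vanishing that stops the new largest part at `r_0`; it is
reproduced because the generating operator squares to zero. -/
theorem expSum_ket_ofPart [CharZero K] (z : K) {D : ℕ} {N : ℤ} (hD : 2 * N ≤ D) (n : ℕ) (c : ℤ)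
    (p : PartSeq) (hn : ∀ k, n ≤ k → p.part k = 0) (h1 : c + n ≤ N) (h2 : -N ≤ c - p.part 0) :
    ∃ L, (truncHeisenberg z D ^ L) (ket K (Maya.ofPart c p)) = 0 ∧
      expSum (truncHeisenberg z D) L (ket K (Maya.ofPart c p)) =
        ∑ r ∈ p.below, z⁻¹ ^ (p.size - r.size) • ket K (Maya.ofPart c r) ∧
      psiStarGeom z⁻¹ D (c - p.part 0)
        (expSum (truncHeisenberg z D) L (ket K (Maya.ofPart c p))) = 0 := by
  induction n generalizing c p with
  | zero =>
    obtain rfl : p = 0 := PartSeq.ext (funext fun k => hn k (Nat.zero_le k))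
    have he : expSum (truncHeisenberg z D) 1 (ket K (Maya.ofPart c 0)) =
        ket K (Maya.ofPart c 0) := by simp [expSum]
    refine ⟨1, ?_, ?_, ?_⟩
    · rw [pow_one, truncHeisenberg_apply]
      refine Finset.sum_eq_zero fun i _ => ?_
      rw [heisenberg_ofPart_zero (by omega), smul_zero]
    · rw [he, PartSeq.below_zero]
      simp
    · rw [he]
      refine Finset.sum_eq_zero fun i _ => ?_
      rw [psiStar_ket_of_mem (Maya.mem_ofPart_of_le (n := 0) (fun _ _ => rfl) (by simp)), smul_zero]
  | succ n ih =>
    obtain ⟨a, r, har, rfl⟩ : ∃ a r, r.part 0 ≤ a ∧ p = PartSeq.cons a r :=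
      ⟨p.part 0, p.tail, p.anti (Nat.zero_le 1), p.cons_tail.symm⟩
    rw [PartSeq.cons_part_zero har] at h2 ⊢
    have hr : ∀ k, n ≤ k → r.part k = 0 := fun k hk => hn (k + 1) (by omega)
    obtain ⟨L, hL, he, hΦ⟩ := ih (c + 1) r hr (by push_cast at h1; omega) (by omega)
    have hbox : ket K (Maya.ofPart (c + 1) r) ∈ boxed K N :=
      ket_ofPart_mem_boxed hr (by push_cast at h1; omega) (by omega)
    obtain ⟨h3, h4⟩ := expSum_psiStar hD h2 hbox hL
    rw [psiStar_ket_ofPart har] at h3 h4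
    refine ⟨_, h3, ?_, ?_⟩
    · rw [h4, psiStarGeom_eq_sum_Icc hD har h2 (expSum_mem_boxed hbox L) hΦ,
        PartSeq.sum_below_cons har, he]
      refine Finset.sum_congr rfl fun b hb => ?_
      rw [map_sum, Finset.smul_sum]
      refine Finset.sum_congr rfl fun t ht => ?_
      have hb := Finset.mem_Icc.mp hb
      have ht := PartSeq.mem_below.mp ht
      have htb : t.part 0 ≤ b := (ht 0).1.trans hb.1
      have hts := ht.size_le
      rw [map_smul, smul_smul, psiStar_ket_ofPart htb, ← pow_add, PartSeq.size_cons har,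
        PartSeq.size_cons htb, show a - b + (r.size - t.size) = a + r.size - (b + t.size) by omega]
    · rw [h4, psiStarGeom_psiStarGeom]

/-- The vertex operator `Γ_+(z)` adds horizontal strips. -/
theorem gammaPlus_ket_ofPart [CharZero K] (z : K) (c : ℤ) (p : PartSeq) :
    gammaPlus z (ket K (Maya.ofPart c p)) =
      ∑ r ∈ p.below, z⁻¹ ^ (p.size - r.size) • ket K (Maya.ofPart c r) := by
  obtain ⟨n, hn⟩ := p.eventually_zero
  -- Large enough that the sites `≥ N` are black and the sites `< -N` white; twice this bounds the
  -- Heisenberg modes that act.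
  set N : ℕ := c.natAbs + n + p.part 0 with hN
  obtain ⟨L, hL, he, _⟩ := expSum_ket_ofPart z (D := 2 * N) (N := N) (by push_cast; rfl) n c p hn
    (by omega) (by omega)
  rw [← he]
  exact gammaPlus_ket_eq_expSum (N := N) (by push_cast; rfl)
    (ket_ofPart_mem_boxed hn (by omega) (by omega)) hL

end VertexOperator

/-! ### The right action on final states is dual to the left action on initial states -/

namespace Maya

theorem dual_dual (s : Maya) : s.dual.dual = s := by
  apply ext_black
  ext i
  simp [dual]

theorem mem_dual {s : Maya} {i : ℤ} : i ∈ s.dual.black ↔ -i ∉ s.black := Iff.rfl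

theorem dual_putWhite (s : Maya) (m : ℤ) : (s.putWhite (-m)).dual = s.dual.putBlack m := by
  apply ext_black
  ext i
  by_cases h : i = m <;> simp [dual, putWhite, putBlack, h]

theorem dual_putBlack (s : Maya) (m : ℤ) : (s.putBlack (-m)).dual = s.dual.putWhite m := by
  apply ext_black
  ext i
  by_cases h : i = m <;> simp [dual, putWhite, putBlack, h]

theorem ncard_white_eq_count_dual (s : Maya) (m : ℤ) :
    Set.ncard {i | i ∉ s.black ∧ -m < i} = s.dual.count m := by
  rw [count, ← Set.ncard_image_of_injective _ neg_injective]
  congr 1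
  ext i
  simp only [Set.mem_image, Set.mem_ofPred_eq, mem_dual]
  constructor
  · rintro ⟨j, ⟨hj, hlt⟩, rfl⟩
    rw [neg_neg]
    exact ⟨hj, by omega⟩
  · rintro ⟨hi, hlt⟩
    exact ⟨-i, ⟨hi, by omega⟩, neg_neg i⟩

theorem dual_initialVacuum : initialVacuum.dual = finalVacuum := by
  apply ext_black
  ext i
  simp [dual, initialVacuum, finalVacuum]

end Maya

section Duality

variable (K : Type) [Field K]

/-- The identification of final states with initial states given by the pairing. -/
def dualFock : FinalFock K ≃ₗ[K] InitialFock K :=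
  Finsupp.domLCongr ⟨Maya.dual, Maya.dual, Maya.dual_dual, Maya.dual_dual⟩

variable {K}

theorem dualFock_bra (f : Maya) : dualFock K (bra K f) = ket K f.dual :=
  Finsupp.domLCongr_single _ _ _

theorem dualFock_apply (v : FinalFock K) (s : Maya) : dualFock K v s = v s.dual := rfl

theorem linearMap_ext_bra {M : Type*} [AddCommGroup M] [Module K M] {f g : FinalFock K →ₗ[K] M}
    (h : ∀ s, f (bra K s) = g (bra K s)) : f = g :=
  Finsupp.lhom_ext' fun s => LinearMap.ext_ring (h s)

theorem dualFock_psiRight (m : ℤ) (v : FinalFock K) :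
    dualFock K (psiRight K m v) = psiStar K m (dualFock K v) := by
  suffices h : (dualFock K).toLinearMap ∘ₗ psiRight K m = psiStar K m ∘ₗ (dualFock K).toLinearMap
    from LinearMap.congr_fun h v
  refine linearMap_ext_bra fun f => ?_
  change dualFock K (psiRight K m (bra K f)) = psiStar K m (dualFock K (bra K f))
  rw [dualFock_bra]
  by_cases h : -m ∈ f.black
  · rw [psiStar_ket_of_notMem (fun hc => Maya.mem_dual.mp hc h), ← Maya.dual_putWhite,
      ← dualFock_bra, ← map_smul, ← Maya.ncard_white_eq_count_dual]
    congr 1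
    simp [psiRight, bra, h]
  · rw [psiStar_ket_of_mem (Maya.mem_dual.mpr h)]
    simp [psiRight, bra, h]

theorem dualFock_psiStarRight (m : ℤ) (v : FinalFock K) :
    dualFock K (psiStarRight K m v) = psi K m (dualFock K v) := by
  suffices h : (dualFock K).toLinearMap ∘ₗ psiStarRight K m = psi K m ∘ₗ (dualFock K).toLinearMap
    from LinearMap.congr_fun h v
  refine linearMap_ext_bra fun f => ?_
  change dualFock K (psiStarRight K m (bra K f)) = psi K m (dualFock K (bra K f))
  rw [dualFock_bra]
  by_cases h : -m ∈ f.black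
  · rw [psi_ket_of_notMem (fun hc => Maya.mem_dual.mp hc h)]
    simp [psiStarRight, bra, h]
  · rw [psi_ket_of_mem (Maya.mem_dual.mpr h), ← Maya.dual_putBlack,
      ← dualFock_bra, ← map_smul, ← Maya.ncard_white_eq_count_dual]
    congr 1
    simp [psiStarRight, bra, h]

theorem dualFock_heisenbergRight {m : ℤ} (hm : m ≠ 0) (f : Maya) :
    dualFock K (heisenbergRight K (-m) (bra K f)) = heisenberg K m (ket K f.dual) := by
  have h1 : heisenbergRight K (-m) (bra K f) =
      ∑ᶠ j : ℤ, psiStarRight K (j + -m) (psiRight K j (bra K f)) := by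
    have h : ∀ j : ℤ, vacuumExpectation K j (j + -m) = 0 := fun j =>
      vacuumExpectation_of_ne (by omega)
    simp only [heisenbergRight, h, zero_smul, sub_zero, bra, Finsupp.linearCombination_single,
      one_smul]
  -- Dualising turns `ψ_j ψ*_{j-m}`, acting from the right, into `ψ_{j-m} ψ*_j`, acting from the
  -- left; the shift `j ↦ j + m` restores the standard form.
  rw [h1, heisenberg_ket hm, AddEquivClass.map_finsum, ← finsum_comp_equiv (Equiv.addRight m)]
  refine finsum_congr fun j => ?_
  rw [dualFock_psiStarRight, dualFock_psiRight, dualFock_bra, Equiv.coe_addRight,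
    add_neg_cancel_right]

theorem timeVar_neg (z : K) (m : ℕ) : timeVar z (-(m : ℤ)) = -timeVar z⁻¹ (m : ℤ) := by
  simp only [timeVar, neg_neg, zpow_neg, inv_zpow, inv_inv, Int.cast_neg, neg_div, div_neg]

theorem dualFock_heisenbergMinus (z : K) (v : FinalFock K) :
    dualFock K (heisenbergMinus z v) = -heisenbergPlus z⁻¹ (dualFock K v) := by
  suffices h : (dualFock K).toLinearMap ∘ₗ heisenbergMinus z =
      -(heisenbergPlus z⁻¹ ∘ₗ (dualFock K).toLinearMap) from LinearMap.congr_fun h v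
  refine linearMap_ext_bra fun f => ?_
  change dualFock K (heisenbergMinus z (bra K f)) = -heisenbergPlus z⁻¹ (dualFock K (bra K f))
  have h1 : heisenbergMinus z (bra K f) = ∑ᶠ m : ℕ+, timeVar z (-((m : ℕ) : ℤ)) •
      heisenbergRight K (-((m : ℕ) : ℤ)) (bra K f) := by
    simp [heisenbergMinus, bra]
  have h2 : heisenbergPlus z⁻¹ (ket K f.dual) = ∑ᶠ m : ℕ+, timeVar z⁻¹ ((m : ℕ) : ℤ) •
      heisenberg K ((m : ℕ) : ℤ) (ket K f.dual) := by
    simp [heisenbergPlus, ket]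
  rw [dualFock_bra, h1, h2, AddEquivClass.map_finsum, ← finsum_neg_distrib]
  refine finsum_congr fun m => ?_
  rw [map_smul, dualFock_heisenbergRight (by exact_mod_cast m.ne_zero), timeVar_neg, neg_smul]

/-- The sign in `Γ_-(z) = exp (-H_-(z))` cancels the one from `timeVar_neg`. -/
theorem dualFock_gammaMinus (z : K) (v : FinalFock K) :
    dualFock K (gammaMinus z v) = gammaPlus z⁻¹ (dualFock K v) := by
  suffices h : (dualFock K).toLinearMap ∘ₗ gammaMinus z =
      gammaPlus z⁻¹ ∘ₗ (dualFock K).toLinearMap from LinearMap.congr_fun h v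
  refine linearMap_ext_bra fun f => ?_
  change dualFock K (gammaMinus z (bra K f)) = gammaPlus z⁻¹ (dualFock K (bra K f))
  have hpow : ∀ (n : ℕ) v, dualFock K (((-heisenbergMinus z) ^ n) v) =
      (heisenbergPlus z⁻¹ ^ n) (dualFock K v) := by
    intro n
    induction n with
    | zero => exact fun _ => rfl
    | succ n ih =>
      intro v
      rw [pow_succ, pow_succ, Module.End.mul_apply, Module.End.mul_apply, ih, LinearMap.neg_apply,
        map_neg, dualFock_heisenbergMinus, neg_neg]
  have h1 : gammaMinus z (bra K f) =
      ∑ᶠ n : ℕ, ((n.factorial : K)⁻¹) • ((-(heisenbergMinus z)) ^ n) (bra K f) := by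
    simp [gammaMinus, bra]
  have h2 : gammaPlus z⁻¹ (ket K f.dual) =
      ∑ᶠ n : ℕ, ((n.factorial : K)⁻¹) • ((heisenbergPlus z⁻¹) ^ n) (ket K f.dual) := by
    simp [gammaPlus, ket]
  rw [dualFock_bra, h1, h2, AddEquivClass.map_finsum]
  refine finsum_congr fun n => ?_
  rw [map_smul, hpow, dualFock_bra]

theorem fockPairing_initialVacuum (v : FinalFock K) :
    fockPairing K v (ket K Maya.initialVacuum) = dualFock K v Maya.initialVacuum := by
  classical
  have h : ∀ f : Maya, (∀ i : ℤ, i ∉ f.black ↔ -i ∈ Maya.initialVacuum.black) ↔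
      f = Maya.finalVacuum := by
    intro f
    constructor
    · intro h
      apply Maya.ext_black
      ext i
      rw [← not_iff_not, h i]
      simp [Maya.finalVacuum, Maya.initialVacuum]
    · rintro rfl i
      simp [Maya.finalVacuum, Maya.initialVacuum]
  rw [dualFock_apply, Maya.dual_initialVacuum, fockPairing, Finsupp.sum]
  simp only [ket]
  rw [Finset.sum_congr rfl fun f _ => Finsupp.sum_single_index (by simp),
    Finset.sum_congr rfl fun f _ => if_congr (h f) (mul_one _) rfl, Finset.sum_ite_eq']
  split_ifs with h0
  · rfl
  · exact (Finsupp.notMem_support_iff.mp h0).symm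

end Duality

/-! ### Matrix elements and their limits -/

section Elements

variable {K : Type} [Field K]

/-- The product `Γ_+(u_{N-1}⁻¹) ⋯ Γ_+(u_0⁻¹)`. -/
def vertexProd (u : ℕ → K) : ℕ → InitialFock K →ₗ[K] InitialFock K
  | 0 => LinearMap.id
  | N + 1 => gammaPlus (u N)⁻¹ ∘ₗ vertexProd u N

/-- The product grows on the left, whereas `chainSum` unfolds from the operator that acts first,
with variable `u 0`. -/
theorem vertexProd_succ (u : ℕ → K) (N : ℕ) :
    vertexProd u (N + 1) = vertexProd (fun k => u (k + 1)) N ∘ₗ gammaPlus (u 0)⁻¹ := by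
  induction N with
  | zero => rfl
  | succ N ih =>
    rw [vertexProd, ih]
    rfl

/-- Each vertex operator preserves the charge and descends by one horizontal strip, so the vacuum is
reached exactly through chains that end at the empty partition. -/
theorem vertexProd_ket_ofPart [CharZero K] (u : ℕ → K) (N : ℕ) (c : ℤ) (p : PartSeq) :
    vertexProd u N (ket K (Maya.ofPart c p)) Maya.initialVacuum =
      if c = 0 then PartSeq.chainSum N u p else 0 := by
  classical
  induction N generalizing u p with
  | zero =>
    rw [vertexProd, LinearMap.id_apply, ket, Finsupp.single_apply, ← Maya.ofPart_zero_zero,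
      PartSeq.chainSum]
    by_cases hc : c = 0
    · subst hc
      rw [if_pos rfl]
      refine if_congr ⟨fun h => (Maya.ofPart_injective h).2, fun h => by rw [h]⟩ rfl rfl
    · rw [if_neg hc, if_neg fun h => hc (Maya.ofPart_injective h).1]
  | succ N ih =>
    rw [vertexProd_succ, LinearMap.comp_apply, gammaPlus_ket_ofPart, inv_inv, map_sum,
      Finsupp.finsetSum_apply]
    simp_rw [map_smul, Finsupp.smul_apply, ih]
    split_ifs with hc
    · rw [PartSeq.chainSum]
      refine Finset.sum_congr rfl fun r hr => ?_
      rw [PartSeq.strip_of_mem hr, smul_eq_mul]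
    · simp

instance : CharZero QField := algebraRat.charZero _

theorem sqrtQ_zpow_odd (M : ℕ) : sqrtQ ^ (2 * ((M : ℤ) + 1) - 1) = sqrtQ ^ (2 * M + 1) := by
  rw [show 2 * ((M : ℤ) + 1) - 1 = ((2 * M + 1 : ℕ) : ℤ) by push_cast; ring, zpow_natCast]

theorem gammaPlusProd_eq (M : ℕ) : gammaPlusProd M = vertexProd (fun k => sqrtQ ^ (2 * k + 1)) M := by
  induction M with
  | zero => rfl
  | succ M ih =>
    rw [gammaPlusProd, vertexProd, ih, ← sqrtQ_zpow_odd, ← zpow_neg]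
    congr 3
    ring

theorem dualFock_gammaMinusProd (N : ℕ) (v : FinalFock QField) :
    dualFock QField (gammaMinusProd N v) =
      vertexProd (fun k => sqrtQ ^ (2 * k + 1)) N (dualFock QField v) := by
  induction N with
  | zero => rfl
  | succ N ih =>
    rw [gammaMinusProd, vertexProd, LinearMap.comp_apply, LinearMap.comp_apply, dualFock_gammaMinus,
      ih, sqrtQ_zpow_odd]

theorem plusElement_ofPart (M : ℕ) (c : ℤ) (p : PartSeq) : plusElement M (Maya.ofPart c p) =
    if c = 0 then PartSeq.chainSum M (fun k => sqrtQ ^ (2 * k + 1)) p else 0 := by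
  rw [plusElement, fockPairing_finalVacuum, gammaPlusProd_eq, vertexProd_ket_ofPart]

theorem minusElement_eq_plusElement (N : ℕ) (s : Maya) : minusElement N s = plusElement N s := by
  rw [minusElement, fockPairing_initialVacuum, dualFock_gammaMinusProd, dualFock_bra,
    Maya.dual_dual, plusElement, fockPairing_finalVacuum, gammaPlusProd_eq]

theorem tendsto_plusElement (c : ℤ) (p : PartSeq) :
    Tendsto (fun M => plusElement M (Maya.ofPart c p)) atTop
      (𝓝 (if c = 0 then PlanePartition.halfSum p else 0)) := by
  simp_rw [plusElement_ofPart]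
  split_ifs with hc
  · exact PartSeq.Chain.tendsto_chainSum p
  · exact tendsto_const_nhds

theorem plusElementInf_ofPart (c : ℤ) (p : PartSeq) :
    plusElementInf (Maya.ofPart c p) = if c = 0 then PlanePartition.halfSum p else 0 :=
  (tendsto_plusElement c p).limUnder_eq

theorem minusElementInf_eq_plusElementInf (s : Maya) : minusElementInf s = plusElementInf s := by
  simp only [minusElementInf, plusElementInf, minusElement_eq_plusElement]

theorem hasSum_plusElementInf_mul_minusElementInf :
    HasSum (fun s : Maya => plusElementInf s * minusElementInf s)
      (∑' π : PlanePartition, qVar ^ π.size) := by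
  -- Only charge `0` contributes, so the sum over Maya diagrams reduces to a sum over partitions,
  -- where both factors are `halfSum`.
  have hinj : Function.Injective (Maya.ofPart 0) := fun _ _ h => (Maya.ofPart_injective h).2
  refine (hinj.hasSum_iff fun s hs => ?_).mp (PlanePartition.hasSum_halfSum_mul.congr_fun fun p => ?_)
  · obtain ⟨c, p, rfl⟩ := s.exists_ofPart
    have hc : c ≠ 0 := fun hc => hs ⟨p, by rw [hc]⟩
    rw [plusElementInf_ofPart, if_neg hc, zero_mul]
  · rw [Function.comp_apply, minusElementInf_eq_plusElementInf, plusElementInf_ofPart, if_pos rfl]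

end Elements

end

theorem mainTheorem4 :
    (∀ s : Maya, Tendsto (fun M : ℕ => plusElement M s) atTop (𝓝 (plusElementInf s))) ∧
    (∀ s : Maya, Tendsto (fun N : ℕ => minusElement N s) atTop (𝓝 (minusElementInf s))) ∧
    HasSum (fun s : Maya => plusElementInf s * minusElementInf s) vertexExpectation ∧
    HasSum (fun π : PlanePartition => qVar ^ π.size) vertexExpectation ∧
    HasProd (fun n : ℕ => (1 / (1 - qVar ^ (n + 1))) ^ (n + 1)) vertexExpectation := by
  have hplus : ∀ s : Maya, Tendsto (fun M : ℕ => plusElement M s) atTop (𝓝 (plusElementInf s)) :=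
    fun s => by
      obtain ⟨c, p, rfl⟩ := s.exists_ofPart
      exact tendsto_nhds_limUnder ⟨_, tendsto_plusElement c p⟩
  have hsum := hasSum_plusElementInf_mul_minusElementInf
  have hV : vertexExpectation = ∑' π : PlanePartition, qVar ^ π.size := hsum.tsum_eq
  rw [hV]
  refine ⟨hplus, fun s => ?_, hsum, PlanePartition.summable_size.hasSum, QField.hasProd_macMahon⟩
  simp_rw [minusElement_eq_plusElement, minusElementInf_eq_plusElementInf]
  exact hplus s
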